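/- Fix $r\ge 1$ and let $\alpha_i=\mathbf e_i-\mathbf e_{i+1}\in\mathbb Z^{r+1}$ for $1\le i\le r$. **Queer graphs.** A *queer graph of dimension $r+1$* is a set of vertices with partial operators $e_i,f_i$ for $i=0,1,\dots,r$ (write $e_i(x)=0$ or $f_i(x)=0$ when undefined) such that $e_i(x)=y\iff f_i(y)=x$, together with a weight map $\mathrm{wt}$ to $\mathbb Z^{r+1}$ such that $\mathrm{wt}(e_i x)=\mathrm{wt}(x)+\alpha_i$ for $i\ge1$ and $\mathrm{wt}(e_0x)=\mathrm{wt}(x)+\alpha_1$ whenever these are defined, and $\varphi_i(x)-\varepsilon_i(x)=\mathrm{wt}(x)_i-\mathrm{wt}(x)_{i+1}$ for $i\ge1$, where $\varepsilon_i(x)=\max\{k: e_i^k x\ne0\}$ and $\varphi_i(x)=\max\{k: f_i^kx\neq0\}$. It is *connected* if it is nonempty and connected as a graph with edges $x\to f_i(x)$ for $0\le i\le r$. It has *degree $3$* if all weights have nonnegative coordinates with sum $3$. It is a *queer crystal* if it is nonempty, all $\varepsilon_i,\varphi_i$ with $i\ge1$ are finite, and for $i\ge3$ the operators $e_0,f_0$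 commute with $e_i,f_i$ and $\varepsilon_i,\varphi_i$ are unchanged by $e_0$ where it is defined. Isomorphisms are bijections of the vertices that respect all operators and weights. **Regularity.** When $e_ix$, resp. $f_ix$, is defined, put $\Delta_i\varepsilon_j(x)=\varepsilon_j(x)-\varepsilon_j(e_ix)$ and $\Delta_i\varphi_j(x)=\varphi_j(e_ix)-\varphi_j(x)$, resp. $\nabla_i\varphi_j(x)=\varphi_j(x)-\varphi_j(f_ix)$. A queer graph is *regular* if the following hold. * (B0) The subgraph of edges with colours $1,\dots,r$ satisfies Stembridge's axioms, where $i,j\in\{1,\dots,r\}$: all monochromatic directed paths are finite; $\Delta_i\varepsilon_j(x)+\Delta_i\varphi_j(x)$ is $2$ if $i=j$, $-1$ if $|i-j|=1$ and $0$ if $|i-j|\ge2$, whenever $e_ix$ is defined; both terms are $\le0$ if $i\ne j$; if $i\neq j$ and $e_ix,e_jx$ are defined, then $\Delta_i\varepsilon_j(x)=0$ implies that $e_ie_jx=e_je_ix=:y$ is defined with $\nabla_j\varphi_i(y)=0$, and $\Delta_i\varepsilon_j(x)=\Delta_j\varepsilon_i(x)=-1$ implies that $e_ie_j^2e_ix=e_je_i^2e_jx=:y$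 is defined with $\nabla_i\varphi_j(y)=\nabla_j\varphi_i(y)=-1$; and dually, if $i\neq j$ and $f_ix,f_jx$ are defined, then $\nabla_i\varphi_j(x)=0$ implies that $f_if_jx=f_jf_ix=:y$ is defined with $\Delta_j\varepsilon_i(y)=0$, and $\nabla_i\varphi_j(x)=\nabla_j\varphi_i(x)=-1$ implies that $f_if_j^2f_ix=f_jf_i^2f_jx=:y$ is defined with $\Delta_i\varepsilon_j(y)=\Delta_j\varepsilon_i(y)=-1$. * (B1) $f_0f_0x=0$ for all $x$, and $\varepsilon_0(x)+\varphi_0(x)=1$ if and only if $\mathrm{wt}(x)_1+\mathrm{wt}(x)_2>0$. * (B2) Every vertex has at most one incoming and at most one outgoing $0$-edge (automatic here, since $e_0$ and $f_0$ are operators). * (B3) If $e_0x$ is defined, $\Delta_0\varepsilon_i(x)+\Delta_0\varphi_i(x)$ is $2$ for $i\le1$, $-1$ for $i=2$, $0$ for $i\ge3$. * (B4) If $e_0x$ is defined: $\Delta_0\varepsilon_1(x)\ge0$ and $\Delta_0\varphi_1(x)>0$; $\Delta_0\varepsilon_2(x)\le0$ and $\Delta_0\varphi_2(x)\le0$; $\Delta_0\varepsilon_i(x)=\Delta_0\varphi_i(x)=0$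 for $i\ge3$. * (B5) For $i\ge2$: $e_ix=e_0y=z$ implies $f_if_0z=f_0f_iz$. For $i=1$ or $i\ge3$: $f_ix=f_0y=z$ and $x\ne y$ imply $e_ie_0z=e_0e_iz$. * (B6) If $e_0x$ is defined: $\Delta_0\varepsilon_1(x)=1$ implies $\varphi_1(x)=0$ and $e_1x=e_0x$; and $\Delta_0\varphi_2(x)=0$ if and only if $\varphi_2(x)=0$. (Clauses about a colour larger than $r$ are void.) **Normal queer crystals.** The standard queer crystal $\mathcal Q(r+1)$ has vertices $1,\dots,r+1$ with $\mathrm{wt}(j)=\mathbf e_j$; the only operators $f_i$ not giving $0$ are $f_i(i)=i+1$ for $1\le i\le r$ and $f_0(1)=2$. On a tensor product, weights add; for $i\ge1$, $f_i(b_1\otimes b_2)$ is $f_i(b_1)\otimes b_2$ if $\varepsilon_i(b_2)<\varphi_i(b_1)$ and $b_1\otimes f_i(b_2)$ otherwise; $f_0(b_1\otimes b_2)$ is $f_0(b_1)\otimes b_2$ if $\mathrm{wt}(b_2)_1=\mathrm{wt}(b_2)_2=0$ and $b_1\otimes f_0(b_2)$ otherwise; $e_i$ is inverse to $f_i$. A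 connected queer crystal is *normal* if it is isomorphic to a connected component of some tensor power $\mathcal Q(r+1)^{\otimes k}$, $k\ge0$. For $1\le i\le r$ let $S_i(b)=f_i^{d}(b)$ if $d=\mathrm{wt}(b)_i-\mathrm{wt}(b)_{i+1}\ge0$ and $S_i(b)=e_i^{-d}(b)$ if $d<0$, and let $e_{\bar\imath}=S_{w}^{-1}e_0S_{w}$ with $S_{w}=S_2\cdots S_i\,S_1\cdots S_{i-1}$ and $S_w^{-1}=S_{i-1}\cdots S_1\,S_i\cdots S_2$ (so $e_{\bar1}=e_0$). A *highest weight element* is a vertex $b$ with $e_i(b)=e_{\bar\imath}(b)=0$ for all $1\le i\le r$. A connected normal queer crystal *has highest weight $\gamma$* if it has exactly one highest weight element and that element has weight $\gamma$. **Proposition.** Every connected regular queer graph $\mathcal Y$ of degree $3$ and dimension $r+1\ge2$ is a normal queer crystal. More precisely, there is $\gamma\in\{(2,1,0,\dots,0),(3,0,0,\dots,0)\}\subset\mathbb Z^{r+1}$ (for $r=1$ read $(2,1)$ and $(3,0)$) such that $\mathcal Y$ is a connected normal queer crystal with highest weight $\gamma$, and $\mathcal Y$ is isomorphic to every connected normal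 queer crystal of dimension $r+1$ with highest weight $\gamma$. -/

import Mathlib

universe u v

/-- The data of a coloured directed graph of dimension `r + 1` with a weight map. The colours are
`0, 1, …, r`, i.e. the elements of `Fin (r + 1)`. The `i`-coloured edges are `e i x → x → f i x`;
`none` plays the role of the extra symbol `0`, i.e. of the absence of an edge. Weights are
elements of `ℤ ^ (r + 1)`; the `j`-th coordinate in 1-based counting has index `j - 1`. -/
structure QueerGraph (r : ℕ) where
  V : Type u
  e : Fin (r + 1) → V → Option V
  f : Fin (r + 1) → V → Option V
  wt : V → Fin (r + 1) → ℤ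

namespace QueerGraph

noncomputable section

/-- The simple root `α_i = 𝐞_i - 𝐞_{i+1}` (1-based coordinates), meaningful for `i ≠ 0`. -/
def simpleRoot {r : ℕ} (i : Fin (r + 1)) : Fin (r + 1) → ℤ :=
  Pi.single (i - 1) 1 - Pi.single i 1

/-- The weight of the operator `e_i`: it is `α_i` for `i ≥ 1`, and `α_1` for `i = 0`. -/
def opRoot {r : ℕ} (i : Fin (r + 1)) : Fin (r + 1) → ℤ :=
  if i = 0 then simpleRoot 1 else simpleRoot i

/-- `iter g k x` is `g^k (x)` for a partial operator `g`. -/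
def iter {V : Type u} (g : V → Option V) : ℕ → V → Option V
  | 0, x => some x
  | k + 1, x => (iter g k x).bind g

variable {r : ℕ} (Y : QueerGraph.{u} r)

/-- The `i`-tail `ε_i(x) = max {k | e_i^k (x) ≠ 0}`. -/
def eps (i : Fin (r + 1)) (x : Y.V) : ℕ := sSup {k | iter (Y.e i) k x ≠ none}

/-- The `i`-head `φ_i(x) = max {k | f_i^k (x) ≠ 0}`. -/
def phi (i : Fin (r + 1)) (x : Y.V) : ℕ := sSup {k | iter (Y.f i) k x ≠ none}

/-- `e_{i₁} e_{i₂} ⋯ e_{iₖ} x` for `w = [i₁, …, iₖ]` (the rightmost operator acts first). -/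
def eWord (w : List (Fin (r + 1))) (x : Y.V) : Option Y.V := w.foldrM Y.e x

/-- `f_{i₁} f_{i₂} ⋯ f_{iₖ} x` for `w = [i₁, …, iₖ]` (the rightmost operator acts first). -/
def fWord (w : List (Fin (r + 1))) (x : Y.V) : Option Y.V := w.foldrM Y.f x

/-- `Δ_i ε_j (x) = ε_j(x) - ε_j(e_i x)` is defined and equal to `d`. -/
def DeltaEps (i j : Fin (r + 1)) (x : Y.V) (d : ℤ) : Prop :=
  ∃ x', Y.e i x = some x' ∧ (Y.eps j x : ℤ) - Y.eps j x' = d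

/-- `Δ_i φ_j (x) = φ_j(e_i x) - φ_j(x)` is defined and equal to `d`. -/
def DeltaPhi (i j : Fin (r + 1)) (x : Y.V) (d : ℤ) : Prop :=
  ∃ x', Y.e i x = some x' ∧ (Y.phi j x' : ℤ) - Y.phi j x = d

/-- `∇_i φ_j (x) = φ_j(x) - φ_j(f_i x)` is defined and equal to `d`. -/
def NablaPhi (i j : Fin (r + 1)) (x : Y.V) (d : ℤ) : Prop :=
  ∃ x', Y.f i x = some x' ∧ (Y.phi j x : ℤ) - Y.phi j x' = d

/-- The operators `e_i` and `f_i` describe the same edges, and the weight map is compatible with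
the edges and with the string lengths of the nonzero colours. -/
structure IsWeightedGraph : Prop where
  edge : ∀ i x y, Y.e i x = some y ↔ Y.f i y = some x
  wt_edge : ∀ i x y, Y.e i x = some y → Y.wt y = Y.wt x + opRoot i
  string : ∀ i, i ≠ 0 → ∀ x,
    (Y.phi i x : ℤ) = (Y.wt x (i - 1) - Y.wt x i) + Y.eps i x

/-! ### Crystals -/

/-- The edges of nonzero colour form a crystal of dimension `r + 1`, and `e_0, f_0` are queer
crystal operators on it. -/
structure IsQueerCrystal : Prop extends Y.IsWeightedGraph where
  nonempty : Nonempty Y.V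
  /-- the maxima which define the string lengths exist -/
  finite : ∀ i, i ≠ 0 → ∀ x,
    (∃ k, iter (Y.e i) k x = none) ∧ ∃ k, iter (Y.f i) k x = none
  comm : ∀ i : Fin (r + 1), 3 ≤ (i : ℕ) → ∀ x,
    (Y.e i x).bind (Y.e 0) = (Y.e 0 x).bind (Y.e i) ∧
    (Y.f i x).bind (Y.e 0) = (Y.e 0 x).bind (Y.f i) ∧
    (Y.e i x).bind (Y.f 0) = (Y.f 0 x).bind (Y.e i) ∧
    (Y.f i x).bind (Y.f 0) = (Y.f 0 x).bind (Y.f i)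
  strings : ∀ i : Fin (r + 1), 3 ≤ (i : ℕ) → ∀ x y, Y.e 0 x = some y →
    Y.phi i y = Y.phi i x ∧ Y.eps i y = Y.eps i x

/-- Two vertices are in the same connected component (edges of all colours, any direction). -/
def Linked : Y.V → Y.V → Prop := Relation.EqvGen fun x y => ∃ i, Y.f i x = some y

/-- The graph is nonempty and connected. -/
def IsConnected : Prop := Nonempty Y.V ∧ ∀ x y, Y.Linked x y

/-- The weights have nonnegative coordinates with sum `d`, i.e. the character
`∑ x ^ wt` is made of monomials of degree `d`. -/
def HasDegree (d : ℤ) : Prop := ∀ x, (∀ j, 0 ≤ Y.wt x j) ∧ ∑ j, Y.wt x j = d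

/-- Isomorphisms: bijections which respect all operators and the weights. -/
structure Iso (Y : QueerGraph.{u} r) (Z : QueerGraph.{v} r) where
  toEquiv : Y.V ≃ Z.V
  map_e : ∀ i x, Z.e i (toEquiv x) = (Y.e i x).map toEquiv
  map_f : ∀ i x, Z.f i (toEquiv x) = (Y.f i x).map toEquiv
  map_wt : ∀ x, Z.wt (toEquiv x) = Y.wt x

open Classical in
/-- The connected component of the vertex `b`. -/
def component (b : Y.V) : QueerGraph.{u} r where
  V := {x : Y.V // Y.Linked b x}
  e i x := (Y.e i x.1).bind fun y => if h : Y.Linked b y then some ⟨y, h⟩ else none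
  f i x := (Y.f i x.1).bind fun y => if h : Y.Linked b y then some ⟨y, h⟩ else none
  wt x := Y.wt x.1

/-! ### Tensor products and normal queer crystals -/

/-- The standard queer crystal; the letter `j` of the usual notation has index `j - 1`. For
`i ≥ 1` the operator `f_i` maps the letter `i` to `i + 1`, and `f_0` maps `1` to `2`. -/
def standard (r : ℕ) : QueerGraph.{0} r where
  V := Fin (r + 1)
  e i j := if i = 0 then (if j = 1 then some 0 else none)
    else if j = i then some (i - 1) else none
  f i j := if i = 0 then (if j = 0 then some 1 else none)
    else if j = i - 1 then some i else none
  wt j := Pi.single j 1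

open Classical in
/-- The tensor product of queer crystals. The formulas for `e_i` are the ones which make `e_i`
inverse to `f_i`. -/
def tensor (A B : QueerGraph.{u} r) : QueerGraph.{u} r where
  V := A.V × B.V
  f i b :=
    if i = 0 then
      if B.wt b.2 0 = 0 ∧ B.wt b.2 1 = 0 then (A.f 0 b.1).map fun c => (c, b.2)
      else (B.f 0 b.2).map fun c => (b.1, c)
    else if B.eps i b.2 < A.phi i b.1 then (A.f i b.1).map fun c => (c, b.2)
    else (B.f i b.2).map fun c => (b.1, c)
  e i b :=
    if i = 0 then
      if B.wt b.2 0 = 0 ∧ B.wt b.2 1 = 0 then (A.e 0 b.1).map fun c => (c, b.2)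
      else (B.e 0 b.2).map fun c => (b.1, c)
    else if B.eps i b.2 ≤ A.phi i b.1 then (A.e i b.1).map fun c => (c, b.2)
    else (B.e i b.2).map fun c => (b.1, c)
  wt b := A.wt b.1 + B.wt b.2

/-- The `k`-fold tensor power of the standard queer crystal; the empty tensor product is the
crystal with a single vertex, which has weight `0`. -/
def standardPow (r : ℕ) : ℕ → QueerGraph.{0} r
  | 0 => { V := Unit, e := fun _ _ => none, f := fun _ _ => none, wt := fun _ => 0 }
  | k + 1 => (standardPow r k).tensor (standard r)

/-- Connected normal queer crystals: connected queer crystals which are isomorphic to a connected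
component of a tensor power of the standard queer crystal. -/
def IsConnectedNormal : Prop :=
  Y.IsQueerCrystal ∧ Y.IsConnected ∧
    ∃ (k : ℕ) (b : (standardPow r k).V), Nonempty (Y.Iso ((standardPow r k).component b))

/-! ### Highest weights -/

/-- The reflection operator `S_i`, for `i ≠ 0`. -/
def reflect (i : Fin (r + 1)) (b : Y.V) : Option Y.V :=
  let d := Y.wt b (i - 1) - Y.wt b i
  if 0 ≤ d then iter (Y.f i) d.toNat b else iter (Y.e i) (-d).toNat b

/-- The word `2, …, i, 1, …, i - 1` of `w_i = s_2 ⋯ s_i s_1 ⋯ s_{i-1}`. -/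
def oddWord (i : Fin (r + 1)) : List (Fin (r + 1)) :=
  (List.range' 2 (i - 1) ++ List.range' 1 (i - 1)).map (Fin.ofNat (r + 1))

/-- The odd raising operator `S_{w_i⁻¹} e_0 S_{w_i}` for `i ≥ 1` (for `i = 1` it is `e_0`). -/
def oddE (i : Fin (r + 1)) (b : Y.V) : Option Y.V :=
  (((oddWord i).foldrM Y.reflect b).bind (Y.e 0)).bind
    fun c => (oddWord i).reverse.foldrM Y.reflect c

/-- Highest weight elements: killed by all `e_i` and all odd `e_i`, `1 ≤ i ≤ r`. -/
def IsHighestWeight (b : Y.V) : Prop :=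
  ∀ i, i ≠ 0 → Y.e i b = none ∧ Y.oddE i b = none

/-- `Y` is a connected normal queer crystal with highest weight `γ`: it has exactly one highest
weight element, and this element has weight `γ`. -/
def IsNormalWithHighestWeight (γ : Fin (r + 1) → ℤ) : Prop :=
  Y.IsConnectedNormal ∧
    ∃ b, Y.IsHighestWeight b ∧ Y.wt b = γ ∧ ∀ b', Y.IsHighestWeight b' → b' = b

/-! ### Regular graphs and regular queer graphs -/

/-- Stembridge's axioms for the subgraph of the edges with nonzero colours. That there is at most
one edge of each colour into and out of each vertex is built into the use of operators. -/
structure IsRegular : Prop where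
  A1 : ∀ i, i ≠ 0 → ∀ x,
    (∃ k, iter (Y.e i) k x = none) ∧ ∃ k, iter (Y.f i) k x = none
  A3 : ∀ i j, i ≠ 0 → j ≠ 0 → ∀ x a b, Y.DeltaEps i j x a → Y.DeltaPhi i j x b →
    a + b = if i = j then 2
      else if (j : ℕ) = i + 1 ∨ (i : ℕ) = j + 1 then -1 else 0
  A4 : ∀ i j, i ≠ 0 → j ≠ 0 → i ≠ j → ∀ x a b, Y.DeltaEps i j x a → Y.DeltaPhi i j x b →
    a ≤ 0 ∧ b ≤ 0
  A5_up : ∀ i j, i ≠ 0 → j ≠ 0 → i ≠ j → ∀ x, Y.e j x ≠ none → Y.DeltaEps i j x 0 →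
    ∃ y, Y.eWord [i, j] x = some y ∧ Y.eWord [j, i] x = some y ∧ Y.NablaPhi j i y 0
  A5_down : ∀ i j, i ≠ 0 → j ≠ 0 → i ≠ j → ∀ x, Y.f j x ≠ none → Y.NablaPhi i j x 0 →
    ∃ y, Y.fWord [i, j] x = some y ∧ Y.fWord [j, i] x = some y ∧ Y.DeltaEps j i y 0
  A6_up : ∀ i j, i ≠ 0 → j ≠ 0 → i ≠ j → ∀ x,
    Y.DeltaEps i j x (-1) → Y.DeltaEps j i x (-1) →
    ∃ y, Y.eWord [i, j, j, i] x = some y ∧ Y.eWord [j, i, i, j] x = some y ∧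
      Y.NablaPhi i j y (-1) ∧ Y.NablaPhi j i y (-1)
  A6_down : ∀ i j, i ≠ 0 → j ≠ 0 → i ≠ j → ∀ x,
    Y.NablaPhi i j x (-1) → Y.NablaPhi j i x (-1) →
    ∃ y, Y.fWord [i, j, j, i] x = some y ∧ Y.fWord [j, i, i, j] x = some y ∧
      Y.DeltaEps i j y (-1) ∧ Y.DeltaEps j i y (-1)

/-- Regular queer graphs. That there is at most one edge of colour `0` into and out of each vertex
is built into the use of operators. -/
structure IsRegularQueer : Prop extends Y.IsWeightedGraph where
  B0 : Y.IsRegular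
  B1_length : ∀ x, iter (Y.f 0) 2 x = none
  B1_wt : ∀ x, Y.eps 0 x + Y.phi 0 x = 1 ↔ 0 < Y.wt x 0 + Y.wt x 1
  B3 : ∀ (i : Fin (r + 1)) x a b, Y.DeltaEps 0 i x a → Y.DeltaPhi 0 i x b →
    a + b = if (i : ℕ) ≤ 1 then 2 else if (i : ℕ) = 2 then -1 else 0
  B4_one : ∀ i : Fin (r + 1), (i : ℕ) = 1 → ∀ x a b,
    Y.DeltaEps 0 i x a → Y.DeltaPhi 0 i x b → 0 ≤ a ∧ 0 < b
  B4_two : ∀ i : Fin (r + 1), (i : ℕ) = 2 → ∀ x a b,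
    Y.DeltaEps 0 i x a → Y.DeltaPhi 0 i x b → a ≤ 0 ∧ b ≤ 0
  B4_ge : ∀ i : Fin (r + 1), 3 ≤ (i : ℕ) → ∀ x a b,
    Y.DeltaEps 0 i x a → Y.DeltaPhi 0 i x b → a = 0 ∧ b = 0
  B5_down : ∀ i : Fin (r + 1), 2 ≤ (i : ℕ) → ∀ x y z,
    Y.e i x = some z → Y.e 0 y = some z → Y.fWord [i, 0] z = Y.fWord [0, i] z
  B5_up : ∀ i : Fin (r + 1), (i : ℕ) = 1 ∨ 3 ≤ (i : ℕ) → ∀ x y z,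
    Y.f i x = some z → Y.f 0 y = some z → x ≠ y → Y.eWord [i, 0] z = Y.eWord [0, i] z
  B6_one : ∀ i : Fin (r + 1), (i : ℕ) = 1 → ∀ x,
    Y.DeltaEps 0 i x 1 → Y.phi i x = 0 ∧ Y.e i x = Y.e 0 x
  B6_two : ∀ i : Fin (r + 1), (i : ℕ) = 2 → ∀ x, Y.e 0 x ≠ none →
    (Y.DeltaPhi 0 i x 0 ↔ Y.phi i x = 0)

end

/-- The weight `(2, 1, 0, …, 0)`. -/
def wt21 (r : ℕ) : Fin (r + 1) → ℤ :=
  fun j => if (j : ℕ) = 0 then 2 else if (j : ℕ) = 1 then 1 else 0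

/-- The weight `(3, 0, 0, …, 0)`. -/
def wt3 (r : ℕ) : Fin (r + 1) → ℤ :=
  fun j => if (j : ℕ) = 0 then 3 else 0

end QueerGraph

/-! The point is rigidity: below a source, the graph is forced by local completions. Take two graphs
with sources of equal weight and pair the vertices that are reached from the sources by the same
words in the `f_i` (`Paired`). If all edges lift along pairs, upwards and downwards, then pairing is
a bisimulation, and for connected graphs it is an isomorphism (`IsConfluent.nonempty_iso`).

Lifting is proved by induction on the height `∑ j * wt_j`, which every `e_i` lowers by one. A pair
`(x, y)` other than the base lies below a common edge from an earlier pair. Another edge into `x` is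
completed together with this one to a square or hexagon above `x`. Its corners other than `x` have
smaller height, so it can be carried over to the second graph, where completing it downwards yields
the missing edge into `y`. Which completions are available is decided by the string lengths `φ_i`,
and these agree on pairs because the weights and the `ε_i` do (`Lifts.succ`).

The completion properties are collected in `IsConfluent`, a common ground for abstract regular
graphs (`IsRegularQueer.isConfluent`) and words of length three (`cube_isConfluent`). Degree 3
enters through colour 0. Distinct edges of colours 0 and 1 into a vertex complete to a square whose
top has `φ_1 = 3`. For colours 0 and 2, either the 0-edge is also a 1-edge, or the vertex has weight
`(1, 1, 1, 0, …)`. For words, every property involves at most four letters, and merging all other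
letters into one leaves a finite check.

At a source all `ε_i` vanish, so its weight is weakly decreasing; the 0-edge excludes `(1, 1, 1, 0,
…)`, which leaves two weights (`IsConfluent.wt_of_isSource`). Both occur at sources among the words.
Sources are the same as highest weight elements, since the coordinate that an odd raising operator
would lower is zero. A normal crystal of the same highest weight must sit in the third tensor power,
because the sum of the weight counts the factors. -/

namespace QueerGraph

/-! ### String lengths -/

/-- `ℓ` counts how often the partial operator `g` can be applied. -/
def IsLength {V : Type u} (g : V → Option V) (l : V → ℕ) : Prop :=
  ∀ x, (g x = none → l x = 0) ∧ ∀ y, g x = some y → l x = l y + 1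

section Length

variable {V : Type u} {g : V → Option V} {l : V → ℕ}

theorem iter_succ' (g : V → Option V) (k : ℕ) (x : V) :
    iter g (k + 1) x = (g x).bind (iter g k) := by
  induction k with
  | zero => simp [iter]
  | succ k ih =>
    rw [iter, ih]
    cases g x <;> simp [iter]

theorem iter_eq_none_of_le {k m : ℕ} {x : V} (h : iter g k x = none) (hkm : k ≤ m) :
    iter g m x = none := by
  induction m, hkm using Nat.le_induction with
  | base => exact h
  | succ m _ ih => rw [iter, ih, Option.bind_none]

theorem IsLength.pos (h : IsLength g l) {x y : V} (hy : g x = some y) : 0 < l x := by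
  have := (h x).2 y hy
  omega

theorem IsLength.exists_of_pos (h : IsLength g l) {x : V} (hx : 0 < l x) : ∃ y, g x = some y := by
  cases hg : g x with
  | none => have := (h x).1 hg; omega
  | some y => exact ⟨y, rfl⟩

theorem IsLength.eq_none (h : IsLength g l) {x : V} (hx : l x = 0) : g x = none := by
  cases hg : g x with
  | none => rfl
  | some y => have := h.pos hg; omega

theorem IsLength.exists_iter (h : IsLength g l) (x : V) :
    ∀ k ≤ l x, ∃ y, iter g k x = some y ∧ l x = l y + k := by
  intro k
  induction k with
  | zero => exact fun _ => ⟨x, rfl, rfl⟩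
  | succ k ih =>
    intro hk
    obtain ⟨y, hy, hl⟩ := ih (by omega)
    obtain ⟨z, hz⟩ := h.exists_of_pos (x := y) (by omega)
    refine ⟨z, by rw [iter, hy, Option.bind_some, hz], ?_⟩
    have := (h y).2 z hz
    omega

/-- A length function is determined by its recursion. This is how closed formulas for `eps` and
`phi` are verified on words. -/
theorem IsLength.sSup_eq (h : IsLength g l) (x : V) : sSup {k | iter g k x ≠ none} = l x := by
  refine IsGreatest.csSup_eq ⟨?_, fun k hk => ?_⟩
  · obtain ⟨y, hy, -⟩ := h.exists_iter x (l x) le_rfl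
    simp [hy]
  · by_contra hlt
    obtain ⟨y, hy, hl⟩ := h.exists_iter x (l x) le_rfl
    refine hk (iter_eq_none_of_le (k := l x + 1) ?_ (by omega))
    rw [iter, hy, Option.bind_some]
    exact h.eq_none (by omega)

/-- The supremum of an unbounded set of naturals is `0`, so finiteness is what makes it a maximum.
One application of `g` then shifts the set by one. -/
theorem isLength_of_finite (h : ∀ x, ∃ k, iter g k x = none) :
    IsLength g fun x => sSup {k | iter g k x ≠ none} := by
  have hgr : ∀ x, IsGreatest {k | iter g k x ≠ none} (sSup {k | iter g k x ≠ none}) := by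
    intro x
    have hb : BddAbove {k | iter g k x ≠ none} := by
      obtain ⟨m, hm⟩ := h x
      refine ⟨m, fun k hk => ?_⟩
      by_contra hlt
      exact hk (iter_eq_none_of_le hm (by omega))
    exact ⟨Nat.sSup_mem ⟨0, by simp [iter]⟩ hb, fun k hk => le_csSup hb hk⟩
  refine fun x => ⟨fun hx => IsGreatest.csSup_eq ⟨by simp [iter], fun k hk => ?_⟩,
    fun y hy => IsGreatest.csSup_eq ⟨?_, fun k hk => ?_⟩⟩
  · cases k with
    | zero => exact le_rfl
    | succ k => exact absurd (by rw [iter_succ', hx, Option.bind_none]) hk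
  · have := (hgr y).1
    rw [Set.mem_ofPred_eq] at this ⊢
    rwa [iter_succ', hy, Option.bind_some]
  · cases k with
    | zero => omega
    | succ k =>
      rw [Set.mem_ofPred_eq, iter_succ', hy, Option.bind_some] at hk
      exact Nat.succ_le_succ ((hgr y).2 hk)

end Length

/-! ### Confluent graphs -/

variable {r : ℕ}

/-- The properties of a queer graph of degree `3` on which its rigidity rests: string lengths are
well defined, and two edges into a vertex, or out of a vertex, can be completed in a way that
the string lengths control. -/
structure IsConfluent (X : QueerGraph.{u} r) : Prop extends X.IsWeightedGraph where
  length_e : ∀ i, IsLength (X.e i) (X.eps i)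
  length_f : ∀ i, IsLength (X.f i) (X.phi i)
  degree : X.HasDegree 3
  zero_length : ∀ x, 0 < X.wt x 0 + X.wt x 1 → X.eps 0 x + X.phi 0 x = 1
  up : ∀ i j, i ≠ 0 → j ≠ 0 → i ≠ j → ∀ x a b, X.e i x = some a → X.e j x = some b →
    (∃ w, X.e j a = some w ∧ X.e i b = some w ∧
      (X.phi i w = X.phi i a ∨ X.phi j w = X.phi j b)) ∨
    ∃ a₁ a₂ b₁ b₂ w, X.e j a = some a₁ ∧ X.e j a₁ = some a₂ ∧ X.e i a₂ = some w ∧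
      X.e i b = some b₁ ∧ X.e i b₁ = some b₂ ∧ X.e j b₂ = some w ∧
      X.phi j a₂ = X.phi j w + 1 ∧ X.phi i b₂ = X.phi i w + 1
  down_square : ∀ i j, i ≠ 0 → j ≠ 0 → i ≠ j → ∀ w a b, X.f i w = some b → X.f j w = some a →
    X.phi i w = X.phi i a → ∃ x, X.f i a = some x ∧ X.f j b = some x
  down_hexagon : ∀ i j, i ≠ 0 → j ≠ 0 → i ≠ j → ∀ w a₂ b₂, X.f i w = some a₂ → X.f j w = some b₂ →
    X.phi j a₂ = X.phi j w + 1 → X.phi i b₂ = X.phi i w + 1 →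
    ∃ a₁ a b₁ b x, X.f j a₂ = some a₁ ∧ X.f j a₁ = some a ∧ X.f i a = some x ∧
      X.f i b₂ = some b₁ ∧ X.f i b₁ = some b ∧ X.f j b = some x
  zero_down : ∀ i : Fin (r + 1), 2 ≤ (i : ℕ) → ∀ w a b, X.f 0 w = some a → X.f i w = some b →
    X.f i a = X.f 0 b
  zero_far_phi : ∀ i : Fin (r + 1), 3 ≤ (i : ℕ) → ∀ w a, X.f 0 w = some a → X.phi i a = X.phi i w
  zero_far_up : ∀ i : Fin (r + 1), 3 ≤ (i : ℕ) → ∀ x a b, X.e 0 x = some a → X.e i x = some b →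
    ∃ w, X.e i a = some w ∧ X.e 0 b = some w
  zero_one : ∀ i : Fin (r + 1), (i : ℕ) = 1 → ∀ w a, X.f 0 w = some a →
    0 < X.phi i w ∧ (X.f i w = some a ↔ X.phi i w = 1)
  zero_one_up : ∀ i : Fin (r + 1), (i : ℕ) = 1 → ∀ x a b, X.e 0 x = some a → X.e i x = some b →
    a ≠ b → ∃ w, X.e i a = some w ∧ X.e 0 b = some w ∧ X.phi i w = 3
  zero_one_down : ∀ i : Fin (r + 1), (i : ℕ) = 1 → ∀ w a b, X.f 0 w = some a → X.f i w = some b →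
    X.phi i w = 3 → ∃ x, X.f i a = some x ∧ X.f 0 b = some x

/-! ### Elementary consequences of confluence -/

theorem val_one (hr : 1 ≤ r) : ((1 : Fin (r + 1)) : ℕ) = 1 := by
  obtain ⟨s, rfl⟩ := Nat.exists_eq_succ_of_ne_zero (Nat.one_le_iff_ne_zero.1 hr)
  simp

theorem val_sub_one {i : Fin (r + 1)} (hi : i ≠ 0) : ((i - 1 : Fin (r + 1)) : ℕ) + 1 = i := by
  have hr : r ≠ 0 := by
    rintro rfl
    exact hi (Fin.ext (by have := i.2; simp only [Fin.val_zero]; omega))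
  obtain ⟨s, rfl⟩ := Nat.exists_eq_succ_of_ne_zero hr
  rw [Fin.coe_sub_one, if_neg hi]
  have : (i : ℕ) ≠ 0 := fun h => hi (Fin.ext h)
  omega

theorem simpleRoot_apply (i j : Fin (r + 1)) :
    simpleRoot i j = (if j = i - 1 then 1 else 0) - if j = i then 1 else 0 := by
  simp [simpleRoot, Pi.single_apply]

/-- The height `∑ j * wt_j` of a vertex. -/
def height (X : QueerGraph.{u} r) (x : X.V) : ℤ := ∑ j : Fin (r + 1), (j : ℤ) * X.wt x j

theorem height_root {i : Fin (r + 1)} (hi : i ≠ 0) :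
    ∑ j : Fin (r + 1), (j : ℤ) * simpleRoot i j = -1 := by
  have := val_sub_one hi
  simp only [simpleRoot_apply, mul_sub, mul_ite, mul_one, mul_zero,
    Finset.sum_sub_distrib, Finset.sum_ite_eq', Finset.mem_univ, if_true]
  omega

/-- Every operator root, also that of colour 0, is a simple root and moves one unit to the preceding
coordinate. Height is therefore a rank function for all colours at once. -/
theorem IsWeightedGraph.height_e {X : QueerGraph.{u} r} (h : X.IsWeightedGraph) (hr : 1 ≤ r)
    {i : Fin (r + 1)} {x y : X.V} (hxy : X.e i x = some y) : X.height y = X.height x - 1 := by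
  have hone : (1 : Fin (r + 1)) ≠ 0 := fun hh => by simpa [hh] using val_one hr
  have hroot : ∑ j : Fin (r + 1), (j : ℤ) * opRoot i j = -1 := by
    unfold opRoot
    split_ifs with hi
    · exact height_root hone
    · exact height_root hi
  simp only [height, h.wt_edge i x y hxy, Pi.add_apply, mul_add, Finset.sum_add_distrib, hroot]
  ring

theorem HasDegree.height_nonneg {X : QueerGraph.{u} r} {d : ℤ} (h : X.HasDegree d) (x : X.V) :
    0 ≤ X.height x :=
  Finset.sum_nonneg fun j _ => mul_nonneg (by positivity) ((h x).1 j)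

namespace IsWeightedGraph

variable {X : QueerGraph.{u} r} (h : X.IsWeightedGraph)

include h

theorem f_iff {i : Fin (r + 1)} {x y : X.V} : X.f i y = some x ↔ X.e i x = some y :=
  (h.edge i x y).symm

/-- The weight of `e_i x` in coordinates. -/
theorem wt_e {i : Fin (r + 1)} (hi : i ≠ 0) {x y : X.V} (hxy : X.e i x = some y)
    (j : Fin (r + 1)) :
    X.wt y j = X.wt x j + (if j = i - 1 then 1 else 0) - if j = i then 1 else 0 := by
  rw [h.wt_edge i x y hxy, Pi.add_apply, opRoot, if_neg hi, simpleRoot_apply]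
  ring

/-- The weight of `e_0 x` in coordinates. -/
theorem wt_e_zero {x y : X.V} (hxy : X.e 0 x = some y) (j : Fin (r + 1)) :
    X.wt y j = X.wt x j + (if j = 0 then 1 else 0) - if j = 1 then 1 else 0 := by
  rw [h.wt_edge 0 x y hxy, Pi.add_apply, opRoot, if_pos rfl, simpleRoot_apply, sub_self]
  ring

/-- Each `f_i` takes one unit from coordinate `i - 1`, which must stay nonnegative. -/
theorem phi_le {d : ℤ} (hd : X.HasDegree d) {i : Fin (r + 1)}
    (hf : IsLength (X.f i) (X.phi i)) (hi : i ≠ 0) (x : X.V) :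
    (X.phi i x : ℤ) ≤ X.wt x (i - 1) := by
  have hne : i - 1 ≠ i := fun hh => by
    have := val_sub_one hi
    rw [hh] at this
    omega
  induction hn : X.phi i x generalizing x with
  | zero => exact_mod_cast (hd x).1 _
  | succ n ih =>
    obtain ⟨y, hy⟩ := hf.exists_of_pos (x := x) (by omega)
    have h1 := ih y (by have := (hf x).2 y hy; omega)
    have h2 := h.wt_e hi (h.f_iff.1 hy) (i - 1)
    simp only [if_true, if_neg hne] at h2
    push_cast
    omega

end IsWeightedGraph

namespace IsConfluent

variable {X : QueerGraph.{u} r} (h : X.IsConfluent)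

include h

theorem eps_succ {i : Fin (r + 1)} {x y : X.V} (hxy : X.e i x = some y) :
    X.eps i x = X.eps i y + 1 := (h.length_e i x).2 y hxy

/-- The coordinate 0 of `a` is 1, so `φ_1(a)` is at most 1; it is positive because `f_0 a` is
defined. The value 1 is exactly the case in which the 0-edge out of `a` is also its 1-edge. -/
theorem zero_one_e {i : Fin (r + 1)} (hi : (i : ℕ) = 1) {x : X.V} {a : X.V}
    (ha : X.e 0 x = some a) (h0 : X.wt x 0 = 0) : X.e i x = some a := by
  have hi0 : i ≠ 0 := fun hh => by simp [hh] at hi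
  have hi1 : i = 1 := Fin.ext (hi.trans (val_one (by have := i.2; omega)).symm)
  have h01 : (0 : Fin (r + 1)) ≠ 1 := by rw [← hi1]; exact hi0.symm
  have hf := h.f_iff.2 ha
  obtain ⟨h1, h2⟩ := h.zero_one i hi a x hf
  have h3 := h.phi_le h.degree (h.length_f i) hi0 a
  have h4 := h.wt_e_zero ha 0
  rw [if_pos rfl, if_neg h01, h0] at h4
  rw [hi1, sub_self, h4, ← hi1] at h3
  exact h.f_iff.1 (h2.2 (by omega))

end IsConfluent

/-! ### Rigidity of confluent graphs -/

/-- The vertices which are reached from `u` and `u'` by the same words in the operators `f_i`. -/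
inductive Paired (X : QueerGraph.{u} r) (Y : QueerGraph.{v} r) (u : X.V) (u' : Y.V) :
    X.V → Y.V → Prop
  | base : Paired X Y u u' u u'
  | step {i : Fin (r + 1)} {x x' : X.V} {y y' : Y.V} : Paired X Y u u' x y →
      X.f i x = some x' → Y.f i y = some y' → Paired X Y u u' x' y'

/-- A vertex without incoming edges. -/
def IsSource (X : QueerGraph.{u} r) (x : X.V) : Prop := ∀ i, X.e i x = none

/-- Paired vertices below height `n` have the same string lengths, and pairs lift along `e_i`. -/
def Lifts (X : QueerGraph.{u} r) (Y : QueerGraph.{v} r) (u : X.V) (u' : Y.V) (n : ℤ) : Prop :=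
  ∀ a b, Paired X Y u u' a b → X.height a < n →
    (∀ i, X.phi i a = Y.phi i b) ∧
    ∀ i a', X.e i a = some a' → ∃ b', Y.e i b = some b' ∧ Paired X Y u u' a' b'

/-! ### Lifting edges into a vertex along pairs -/

section Rigid

variable {X : QueerGraph.{u} r} {Y : QueerGraph.{v} r} {u : X.V} {u' : Y.V}

theorem Paired.symm {x : X.V} {y : Y.V} (h : Paired X Y u u' x y) : Paired Y X u' u y x := by
  induction h with
  | base => exact .base
  | step _ h1 h2 ih => exact .step ih h2 h1

theorem Paired.wt_eq (hX : X.IsWeightedGraph) (hY : Y.IsWeightedGraph)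
    (hw : X.wt u = Y.wt u') {x : X.V} {y : Y.V} (h : Paired X Y u u' x y) :
    X.wt x = Y.wt y := by
  induction h with
  | base => exact hw
  | @step i x x' y y' _ h1 h2 ih =>
    have h3 := hX.wt_edge i x' x ((hX.edge _ _ _).2 h1)
    have h4 := hY.wt_edge i y' y ((hY.edge _ _ _).2 h2)
    rw [h3, h4] at ih
    exact add_right_cancel ih

theorem height_congr {x : X.V} {y : Y.V} (h : X.wt x = Y.wt y) : X.height x = Y.height y := by
  simp only [height, h]

variable (hr : 1 ≤ r) (hX : X.IsConfluent) (hY : Y.IsConfluent)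

include hX hY in
/-- Lifting along `f_i`. -/
theorem Lifts.down {n : ℤ} (hL : Lifts X Y u u' n) {a a' : X.V} {b : Y.V}
    (hab : Paired X Y u u' a b) (hn : X.height a < n) {i : Fin (r + 1)} (ha : X.f i a = some a') :
    ∃ b', Y.f i b = some b' ∧ Paired X Y u u' a' b' := by
  have h1 := (hX.length_f i).pos ha
  -- Equality of string lengths is what provides the lower edge in `Y`.
  rw [(hL a b hab hn).1 i] at h1
  obtain ⟨b', hb'⟩ := (hY.length_f i).exists_of_pos h1
  exact ⟨b', hb', hab.step ha hb'⟩

include hr hX hY in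
/-- Edges of nonzero colour lift below a common edge of nonzero colour. -/
theorem Lifts.step_nonzero {n : ℤ} (hL : Lifts X Y u u' n) {i j : Fin (r + 1)} (hi : i ≠ 0)
    (hj : j ≠ 0) {x x₀ a : X.V} {y y₀ : Y.V} (h₀ : Paired X Y u u' x₀ y₀)
    (hn : X.height x = n) (hx : X.e j x = some x₀) (hy : Y.e j y = some y₀)
    (ha : X.e i x = some a) : ∃ b, Y.e i y = some b ∧ Paired X Y u u' a b := by
  by_cases hij : i = j
  · subst hij
    obtain rfl : x₀ = a := Option.some_inj.1 (hx.symm.trans ha)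
    exact ⟨y₀, hy, h₀⟩
  have hx₀ := hX.height_e hr hx
  have hha := hX.height_e hr ha
  -- Climb from `x₀` to the top `w` and descend to `a`, lifting each edge to `Y`. The equality of
  -- `φ` at the top permits the completion downwards in `Y`; its bottom is `y`, the only vertex that
  -- `f_j` reaches from `y₀`.
  rcases hX.up i j hi hj hij x a x₀ ha hx with ⟨w, hw1, hw2, hw⟩ |
    ⟨a₁, a₂, b₁, b₂, w, ha1, ha2, ha3, hb1, hb2, hb3, hpa, hpb⟩
  · have hhw := hX.height_e hr hw2
    obtain ⟨w', hw', hww⟩ := (hL _ _ h₀ (by omega)).2 i w hw2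
    obtain ⟨z', hz', haz⟩ := hL.down hX hY hww (by omega) (hX.f_iff.2 hw1)
    have hfy := hY.f_iff.2 hw'
    have e1 := (hL _ _ hww (by omega)).1
    have e2 := (hL _ _ haz (by omega)).1
    have e3 := (hL _ _ h₀ (by omega)).1
    refine ⟨z', ?_, haz⟩
    rcases hw with hw | hw
    · obtain ⟨t, ht1, ht2⟩ := hY.down_square i j hi hj hij w' z' y₀ hfy hz'
        (by rw [← e1, ← e2, hw])
      rw [hY.f_iff.2 hy] at ht2
      rw [← hY.f_iff, ht1, ht2]
    · obtain ⟨t, ht1, ht2⟩ := hY.down_square j i hj hi (Ne.symm hij) w' y₀ z' hz' hfy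
        (by rw [← e1, ← e3, hw])
      rw [hY.f_iff.2 hy] at ht1
      rw [← hY.f_iff, ht2, ht1]
  -- The same walk around a hexagon, up the side of `x₀` and down the side of `a`. All its vertices
  -- lie strictly below height `n`.
  · have k1 := hX.height_e hr hb1
    have k2 := hX.height_e hr hb2
    have k3 := hX.height_e hr hb3
    have k4 := hX.height_e hr ha1
    have k5 := hX.height_e hr ha2
    obtain ⟨b₁', hb1', p1⟩ := (hL _ _ h₀ (by omega)).2 i _ hb1
    obtain ⟨b₂', hb2', p2⟩ := (hL _ _ p1 (by omega)).2 i _ hb2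
    obtain ⟨w', hw', pw⟩ := (hL _ _ p2 (by omega)).2 j _ hb3
    obtain ⟨a₂', ha2', q2⟩ := hL.down hX hY pw (by omega) (hX.f_iff.2 ha3)
    obtain ⟨a₁', ha1', q1⟩ := hL.down hX hY q2 (by omega) (hX.f_iff.2 ha2)
    obtain ⟨a', ha', q⟩ := hL.down hX hY q1 (by omega) (hX.f_iff.2 ha1)
    have e1 := (hL _ _ pw (by omega)).1
    have e2 := (hL _ _ q2 (by omega)).1
    have e3 := (hL _ _ p2 (by omega)).1
    obtain ⟨c₁, c, d₁, d, t, g1, g2, g3, g4, g5, g6⟩ :=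
      hY.down_hexagon i j hi hj hij w' a₂' b₂' ha2' (hY.f_iff.2 hw')
        (by rw [← e1, ← e2, hpa]) (by rw [← e1, ← e3, hpb])
    obtain rfl : a₁' = c₁ := Option.some_inj.1 (ha1'.symm.trans g1)
    obtain rfl : a' = c := Option.some_inj.1 (ha'.symm.trans g2)
    obtain rfl : b₁' = d₁ := Option.some_inj.1 ((hY.f_iff.2 hb2').symm.trans g4)
    obtain rfl : y₀ = d := Option.some_inj.1 ((hY.f_iff.2 hb1').symm.trans g5)
    obtain rfl : y = t := Option.some_inj.1 ((hY.f_iff.2 hy).symm.trans g6)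
    exact ⟨a', hY.f_iff.1 g3, q⟩

include hX hY hr in
/-- If two edges of colours `i, j` into `x` can be completed to a square, and pairs of edges of
these colours from the images of the top of the square can be completed as well, then the edge of
colour `i` lifts below the edge of colour `j`. -/
theorem Lifts.step_of_square {n : ℤ} (hL : Lifts X Y u u' n) {i j : Fin (r + 1)}
    {x x₀ a w : X.V} {y y₀ : Y.V} (h₀ : Paired X Y u u' x₀ y₀)
    (hn : X.height x = n) (hx : X.e j x = some x₀) (hy : Y.e j y = some y₀)
    (hw1 : X.e j a = some w) (hw2 : X.e i x₀ = some w)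
    (hdown : ∀ w' z' : Y.V, Paired X Y u u' w w' → Paired X Y u u' a z' → Y.f i w' = some y₀ →
      Y.f j w' = some z' → Y.f i z' = Y.f j y₀) :
    ∃ b, Y.e i y = some b ∧ Paired X Y u u' a b := by
  have hx₀ := hX.height_e hr hx
  have hhw := hX.height_e hr hw2
  obtain ⟨w', hw', hww⟩ := (hL _ _ h₀ (by omega)).2 i w hw2
  obtain ⟨z', hz', haz⟩ := hL.down hX hY hww (by omega) (hX.f_iff.2 hw1)
  refine ⟨z', ?_, haz⟩
  rw [← hY.f_iff, hdown w' z' hww haz (hY.f_iff.2 hw') hz', hY.f_iff, hy]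

include hX hY hr in
-- Colours 0 and `k ≥ 3` commute in both directions, so the square closes without any condition on
-- string lengths.
theorem Lifts.step_far {n : ℤ} (hL : Lifts X Y u u' n) {i j k : Fin (r + 1)} (hk : 3 ≤ (k : ℕ))
    (hij : (i = 0 ∧ j = k) ∨ (i = k ∧ j = 0))
    {x x₀ a : X.V} {y y₀ : Y.V} (h₀ : Paired X Y u u' x₀ y₀)
    (hn : X.height x = n) (hx : X.e j x = some x₀) (hy : Y.e j y = some y₀)
    (ha : X.e i x = some a) : ∃ b, Y.e i y = some b ∧ Paired X Y u u' a b := by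
  rcases hij with ⟨rfl, rfl⟩ | ⟨rfl, rfl⟩
  · obtain ⟨w, hw1, hw2⟩ := hX.zero_far_up _ hk _ _ _ ha hx
    exact hL.step_of_square hr hX hY h₀ hn hx hy hw1 hw2 fun w' z' _ _ h1 h2 =>
      (hY.zero_down _ (by omega) _ _ _ h1 h2).symm
  · obtain ⟨w, hw1, hw2⟩ := hX.zero_far_up _ hk _ _ _ hx ha
    exact hL.step_of_square hr hX hY h₀ hn hx hy hw2 hw1 fun w' z' _ _ h1 h2 =>
      hY.zero_down _ (by omega) _ _ _ h2 h1

include hX hY hr in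
-- The edges of colours 0 and 1 into `x` may have the same upper end. This is detected by `φ_1 = 1`
-- there, a condition shared by paired vertices. Otherwise there is a square whose top has `φ_1 =
-- 3`, and this value guarantees that the square closes in `Y`.
theorem Lifts.step_one {n : ℤ} (hL : Lifts X Y u u' n) {i j k : Fin (r + 1)} (hk : (k : ℕ) = 1)
    (hij : (i = 0 ∧ j = k) ∨ (i = k ∧ j = 0))
    {x x₀ a : X.V} {y y₀ : Y.V} (h₀ : Paired X Y u u' x₀ y₀)
    (hn : X.height x = n) (hx : X.e j x = some x₀) (hy : Y.e j y = some y₀)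
    (ha : X.e i x = some a) : ∃ b, Y.e i y = some b ∧ Paired X Y u u' a b := by
  have hx₀ := hX.height_e hr hx
  have hp := (hL _ _ h₀ (by omega)).1
  by_cases hax : a = x₀
  · subst hax
    refine ⟨y₀, ?_, h₀⟩
    rcases hij with ⟨rfl, rfl⟩ | ⟨rfl, rfl⟩
    · have h1 := (hX.zero_one _ hk _ _ (hX.f_iff.2 ha)).2.1 (hX.f_iff.2 hx)
      obtain ⟨b', hb', -⟩ := hL.down hX hY h₀ (by omega) (hX.f_iff.2 ha)
      have h2 := (hY.zero_one _ hk _ _ hb').2.2 (by rw [← hp, h1])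
      rw [hY.f_iff.2 hy] at h2
      rw [← hY.f_iff, hb', h2]
    · have h1 := (hX.zero_one _ hk _ _ (hX.f_iff.2 hx)).2.1 (hX.f_iff.2 ha)
      exact hY.f_iff.1 ((hY.zero_one _ hk _ _ (hY.f_iff.2 hy)).2.2 (by rw [← hp, h1]))
  rcases hij with ⟨rfl, rfl⟩ | ⟨rfl, rfl⟩
  · obtain ⟨w, hw1, hw2, hw3⟩ := hX.zero_one_up _ hk _ _ _ ha hx hax
    refine hL.step_of_square hr hX hY h₀ hn hx hy hw1 hw2 fun w' z' hww _ h1 h2 => ?_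
    have hhw := hX.height_e hr hw2
    obtain ⟨t, ht1, ht2⟩ := hY.zero_one_down _ hk _ _ _ h1 h2
      (by rw [← (hL _ _ hww (by omega)).1, hw3])
    rw [ht1, ht2]
  · obtain ⟨w, hw1, hw2, hw3⟩ := hX.zero_one_up _ hk _ _ _ hx ha (Ne.symm hax)
    refine hL.step_of_square hr hX hY h₀ hn hx hy hw2 hw1 fun w' z' hww _ h1 h2 => ?_
    have hhw := hX.height_e hr hw1
    obtain ⟨t, ht1, ht2⟩ := hY.zero_one_down _ hk _ _ _ h2 h1
      (by rw [← (hL _ _ hww (by omega)).1, hw3])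
    rw [ht1, ht2]

include hX hr in
/-- Edges of colours `0` and `2` into a vertex of weight `(1, 1, 1, 0, …)`. -/
theorem IsConfluent.zero_two_up {k : Fin (r + 1)} (hk : (k : ℕ) = 2) {x a b : X.V}
    (h0 : X.wt x 0 ≠ 0) (ha : X.e 0 x = some a) (hb : X.e k x = some b) :
    ∃ w, X.e k a = some w ∧ X.e 0 b = some w := by
  have v1 := val_one hr
  have hk0 : k ≠ 0 := fun hh => by simp [hh] at hk
  have hk1 : k - 1 = 1 := Fin.ext (by have := val_sub_one hk0; omega)
  have h10 : (1 : Fin (r + 1)) ≠ 0 := fun hh => by simp [hh] at v1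
  have h1k : (1 : Fin (r + 1)) ≠ k := fun hh => by rw [hh] at v1; omega
  -- Since `e_0 x` and `e_k x` are defined, coordinates 1 and `k` are positive. Coordinate 0 is
  -- positive by `h0`, so all three equal 1.
  have hsum : ∑ j ∈ ({0, 1, k} : Finset (Fin (r + 1))), X.wt x j ≤ 3 := by
    rw [← (hX.degree x).2]
    exact Finset.sum_le_univ_sum_of_nonneg (hX.degree x).1
  rw [Finset.sum_insert (by simp [h10.symm, hk0.symm]), Finset.sum_insert (by simpa using h1k),
    Finset.sum_singleton] at hsum
  have w0 := (hX.degree x).1 0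
  have wa := (hX.degree a).1 1
  have wb := (hX.degree b).1 k
  have ga := hX.wt_e_zero ha 1
  have gb := hX.wt_e hk0 hb
  have gb0 := gb 0
  have gb1 := gb 1
  have gbk := gb k
  rw [hk1] at gb0 gb1 gbk
  simp only [if_neg h10, if_neg h10.symm, if_neg hk0.symm, if_neg h1k, if_neg h1k.symm,
    if_true] at ga gb0 gb1 gbk
  have hlen := hX.zero_length b (by omega)
  -- The weight of `b` is `(1, 2, 0, …)`, so exactly one of `e_0 b` and `f_0 b` is defined. In the
  -- first case `w = e_0 b` has weight `(2, 1, 0, …)`, hence `f_k w` is defined and `zero_down`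
  -- closes the square.
  rcases Nat.eq_zero_or_pos (X.phi 0 b) with hf | hf
  · obtain ⟨w, hw⟩ := (hX.length_e 0).exists_of_pos (x := b) (by omega)
    have gw := hX.wt_e_zero hw
    have gw1 := gw 1
    have gwk := gw k
    simp only [if_neg h10, if_neg hk0, if_neg h1k.symm, if_true] at gw1 gwk
    have hs := hX.string k hk0 w
    rw [hk1] at hs
    obtain ⟨t, ht⟩ := (hX.length_f k).exists_of_pos (x := w) (by omega)
    have hd := hX.zero_down k (by omega) w b t (hX.f_iff.2 hw) ht
    rw [hX.f_iff.2 hb] at hd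
    obtain rfl : a = t := Option.some_inj.1 (ha.symm.trans (hX.f_iff.1 hd.symm))
    exact ⟨w, hX.f_iff.1 ht, hw⟩
  -- Here `t = f_0 b` has weight `(0, 3, 0, …)`, so `f_k t` is defined. By `zero_down` it equals
  -- `f_0 x`, which cannot exist next to `e_0 x` in a 0-string of length one.
  · obtain ⟨t, ht⟩ := (hX.length_f 0).exists_of_pos hf
    have gt := hX.wt_e_zero (hX.f_iff.1 ht)
    have gt1 := gt 1
    have gtk := gt k
    simp only [if_neg h10, if_neg hk0, if_neg h1k.symm, if_true] at gt1 gtk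
    have hs := hX.string k hk0 t
    rw [hk1] at hs
    obtain ⟨s, hs⟩ := (hX.length_f k).exists_of_pos (x := t) (by omega)
    have hd := hX.zero_down k (by omega) b t x ht (hX.f_iff.2 hb)
    have h3 := (hX.length_f 0).pos (hd.symm.trans hs)
    have h4 := (hX.length_e 0).pos ha
    have h5 := hX.zero_length x (by omega)
    omega

include hX hY hr in
-- A completion above `x` may fail when coordinate 0 of the weight vanishes. In that case the 0-edge
-- is also a 1-edge, and the lift passes through colour 1: one step compares colours 1 and 2, the
-- other colours 0 and 1.
theorem Lifts.step_two {n : ℤ} (hL : Lifts X Y u u' n) {i j k : Fin (r + 1)} (hk : (k : ℕ) = 2)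
    (hij : (i = 0 ∧ j = k) ∨ (i = k ∧ j = 0))
    {x x₀ a : X.V} {y y₀ : Y.V} (h₀ : Paired X Y u u' x₀ y₀)
    (hn : X.height x = n) (hx : X.e j x = some x₀) (hy : Y.e j y = some y₀)
    (ha : X.e i x = some a) : ∃ b, Y.e i y = some b ∧ Paired X Y u u' a b := by
  have v1 := val_one hr
  have hk0 : k ≠ 0 := fun hh => by simp [hh] at hk
  have h10 : (1 : Fin (r + 1)) ≠ 0 := fun hh => by simp [hh] at v1
  by_cases h0 : X.wt x 0 = 0
  · rcases hij with ⟨rfl, rfl⟩ | ⟨rfl, rfl⟩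
    · have h1 := hX.zero_one_e v1 ha h0
      obtain ⟨b, hb, hab⟩ := hL.step_nonzero hr hX hY h10 hk0 h₀ hn hx hy h1
      exact hL.step_one hr hX hY v1 (.inl ⟨rfl, rfl⟩) hab hn h1 hb ha
    · have h1 := hX.zero_one_e v1 hx h0
      obtain ⟨b, hb, hab⟩ := hL.step_one hr hX hY v1 (.inr ⟨rfl, rfl⟩) h₀ hn hx hy h1
      exact hL.step_nonzero hr hX hY hk0 h10 hab hn h1 hb ha
  · rcases hij with ⟨rfl, rfl⟩ | ⟨rfl, rfl⟩
    · obtain ⟨w, hw1, hw2⟩ := hX.zero_two_up hr hk h0 ha hx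
      exact hL.step_of_square hr hX hY h₀ hn hx hy hw1 hw2 fun w' z' _ _ h1 h2 =>
        (hY.zero_down _ (by omega) _ _ _ h1 h2).symm
    · obtain ⟨w, hw1, hw2⟩ := hX.zero_two_up hr hk h0 hx ha
      exact hL.step_of_square hr hX hY h₀ hn hx hy hw2 hw1 fun w' z' _ _ h1 h2 =>
        hY.zero_down _ (by omega) _ _ _ h2 h1

include hX hY hr in
theorem Lifts.step {n : ℤ} (hL : Lifts X Y u u' n) {i j : Fin (r + 1)}
    {x x₀ a : X.V} {y y₀ : Y.V} (h₀ : Paired X Y u u' x₀ y₀)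
    (hn : X.height x = n) (hx : X.e j x = some x₀) (hy : Y.e j y = some y₀)
    (ha : X.e i x = some a) : ∃ b, Y.e i y = some b ∧ Paired X Y u u' a b := by
  by_cases hij : i = j
  · subst hij
    obtain rfl : x₀ = a := Option.some_inj.1 (hx.symm.trans ha)
    exact ⟨y₀, hy, h₀⟩
  by_cases hi : i = 0
  · have hj : (j : ℕ) ≠ 0 := fun hh => hij (hi.trans (Fin.ext hh.symm))
    rcases (by omega : (j : ℕ) = 1 ∨ (j : ℕ) = 2 ∨ 3 ≤ (j : ℕ)) with hk | hk | hk
    · exact hL.step_one hr hX hY hk (.inl ⟨hi, rfl⟩) h₀ hn hx hy ha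
    · exact hL.step_two hr hX hY hk (.inl ⟨hi, rfl⟩) h₀ hn hx hy ha
    · exact hL.step_far hr hX hY hk (.inl ⟨hi, rfl⟩) h₀ hn hx hy ha
  by_cases hj : j = 0
  · have hi : (i : ℕ) ≠ 0 := fun hh => hi (Fin.ext hh)
    rcases (by omega : (i : ℕ) = 1 ∨ (i : ℕ) = 2 ∨ 3 ≤ (i : ℕ)) with hk | hk | hk
    · exact hL.step_one hr hX hY hk (.inr ⟨rfl, hj⟩) h₀ hn hx hy ha
    · exact hL.step_two hr hX hY hk (.inr ⟨rfl, hj⟩) h₀ hn hx hy ha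
    · exact hL.step_far hr hX hY hk (.inr ⟨rfl, hj⟩) h₀ hn hx hy ha
  · exact hL.step_nonzero hr hX hY hi hj h₀ hn hx hy ha

end Rigid

/-! ### From lifting to isomorphism -/

section Rigid

variable {X : QueerGraph.{u} r} {Y : QueerGraph.{v} r} {u : X.V} {u' : Y.V}

theorem IsConfluent.zero_eq_zero (hX : X.IsConfluent) (hr : 1 ≤ r) {x : X.V}
    (h : ¬ 0 < X.wt x 0 + X.wt x 1) : X.eps 0 x = 0 ∧ X.phi 0 x = 0 := by
  have h10 : (1 : Fin (r + 1)) ≠ 0 := fun hh => by simpa [hh] using val_one hr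
  have h0 := (hX.degree x).1 0
  have h1 := (hX.degree x).1 1
  constructor
  · by_contra hne
    obtain ⟨y, hy⟩ := (hX.length_e 0).exists_of_pos (Nat.pos_of_ne_zero hne)
    have h2 := hX.wt_e_zero hy 1
    have h3 := (hX.degree y).1 1
    simp only [if_neg h10, if_true] at h2
    omega
  · by_contra hne
    obtain ⟨y, hy⟩ := (hX.length_f 0).exists_of_pos (Nat.pos_of_ne_zero hne)
    have h2 := hX.wt_e_zero (hX.f_iff.1 hy) 0
    have h3 := (hX.degree y).1 0
    simp only [if_neg h10.symm, if_true] at h2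
    omega

/-- The weight fixes `φ_i - ε_i` for `i ≠ 0`, and it fixes `ε_0 + φ_0`, which is 1 or 0. -/
theorem IsConfluent.eps_eq_iff (hX : X.IsConfluent) (hY : Y.IsConfluent) (hr : 1 ≤ r)
    {x : X.V} {y : Y.V} (hw : X.wt x = Y.wt y) (i : Fin (r + 1)) :
    X.eps i x = Y.eps i y ↔ X.phi i x = Y.phi i y := by
  by_cases hi : i = 0
  · subst hi
    by_cases h : 0 < X.wt x 0 + X.wt x 1
    · have h1 := hX.zero_length x h
      have h2 := hY.zero_length y (by rwa [← hw])
      omega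
    · have h1 := hX.zero_eq_zero hr h
      have h2 := hY.zero_eq_zero hr (x := y) (by rwa [← hw])
      omega
  · have h1 := hX.string i hi x
    have h2 := hY.string i hi y
    rw [hw] at h1
    omega

/-- A pair of height `n` is the base, where nothing has to be lifted, or lies below an earlier pair,
where `Lifts.step` applies. Both directions are needed to see that `a` and `b` have raising edges of
the same colours. Then `ε_i` agrees because it agrees one edge higher, and the weight yields `φ_i`.
-/
theorem Lifts.succ (hr : 1 ≤ r) (hX : X.IsConfluent) (hY : Y.IsConfluent)
    (hu : X.IsSource u) (hu' : Y.IsSource u') (hw : X.wt u = Y.wt u') {n : ℤ}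
    (hL : Lifts X Y u u' n) (hL' : Lifts Y X u' u n) : Lifts X Y u u' (n + 1) := by
  intro a b hab hn
  rcases (by omega : X.height a < n ∨ X.height a = n) with hlt | heq
  · exact hL a b hab hlt
  have hwab := hab.wt_eq hX.toIsWeightedGraph hY.toIsWeightedGraph hw
  have hb : Y.height b = n := (height_congr hwab).symm.trans heq
  have hlift : (∀ i a', X.e i a = some a' → ∃ b', Y.e i b = some b' ∧ Paired X Y u u' a' b') ∧
      ∀ i b', Y.e i b = some b' → ∃ a', X.e i a = some a' ∧ Paired Y X u' u b' a' := by
    cases hab with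
    | base => exact ⟨fun i a' h => by simp [hu i] at h, fun i b' h => by simp [hu' i] at h⟩
    | @step j x₀ _ y₀ _ h₀ h1 h2 =>
      exact ⟨fun i a' ha' => hL.step hr hX hY h₀ heq (hX.f_iff.1 h1) (hY.f_iff.1 h2) ha',
        fun i b' hb' => hL'.step hr hY hX h₀.symm hb (hY.f_iff.1 h2) (hX.f_iff.1 h1) hb'⟩
  refine ⟨fun i => (hX.eps_eq_iff hY hr hwab i).1 ?_, hlift.1⟩
  cases hea : X.e i a with
  | none =>
    cases heb : Y.e i b with
    | none => rw [(hX.length_e i a).1 hea, (hY.length_e i b).1 heb]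
    | some b' =>
      obtain ⟨a', ha', -⟩ := hlift.2 i b' heb
      simp [hea] at ha'
  | some a' =>
    obtain ⟨b', hb', hp⟩ := hlift.1 i a' hea
    have hht := hX.height_e hr hea
    rw [hX.eps_succ hea, hY.eps_succ hb', (hX.eps_eq_iff hY hr
      (hp.wt_eq hX.toIsWeightedGraph hY.toIsWeightedGraph hw) i).2 ((hL a' b' hp (by omega)).1 i)]

/-- Pairs of vertices form a bisimulation. -/
theorem Lifts.all (hr : 1 ≤ r) (hX : X.IsConfluent) (hY : Y.IsConfluent)
    (hu : X.IsSource u) (hu' : Y.IsSource u') (hw : X.wt u = Y.wt u') (n : ℕ) :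
    Lifts X Y u u' n ∧ Lifts Y X u' u n := by
  induction n with
  | zero =>
    refine ⟨fun a b _ h => ?_, fun a b _ h => ?_⟩
    · have := hX.degree.height_nonneg a
      norm_num at h
      omega
    · have := hY.degree.height_nonneg a
      norm_num at h
      omega
  | succ n ih =>
    push_cast
    exact ⟨ih.1.succ hr hX hY hu hu' hw ih.2, ih.2.succ hr hY hX hu' hu hw.symm ih.1⟩

theorem Paired.lift (hr : 1 ≤ r) (hX : X.IsConfluent) (hY : Y.IsConfluent)
    (hu : X.IsSource u) (hu' : Y.IsSource u') (hw : X.wt u = Y.wt u')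
    {x : X.V} {y : Y.V} (h : Paired X Y u u' x y) (i : Fin (r + 1)) :
    (∀ x', X.e i x = some x' → ∃ y', Y.e i y = some y' ∧ Paired X Y u u' x' y') ∧
    ∀ x', X.f i x = some x' → ∃ y', Y.f i y = some y' ∧ Paired X Y u u' x' y' := by
  have hL := (Lifts.all hr hX hY hu hu' hw ((X.height x).toNat + 1)).1
  have hlt : X.height x < ((X.height x).toNat + 1 : ℕ) := by
    push_cast
    have := Int.self_le_toNat (X.height x)
    omega
  exact ⟨(hL x y h hlt).2 i, fun x' hx' => hL.down hX hY h hlt hx'⟩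

theorem Paired.eq_of_isSource (hY : Y.IsConfluent) {x : X.V} {y : Y.V}
    (h : Paired X Y u u' x y) (hy : Y.IsSource y) : x = u ∧ y = u' := by
  cases h with
  | base => exact ⟨rfl, rfl⟩
  | @step i x₀ _ y₀ _ _ _ h2 =>
    have := hY.f_iff.1 h2
    simp [hy i] at this

/-- Raise `y` and lift this edge to both partners. Their upper neighbours coincide by induction on
the height, and `f_i` is single-valued. At a source only the base pair remains. -/
theorem Paired.left_unique (hr : 1 ≤ r) (hX : X.IsConfluent) (hY : Y.IsConfluent)
    (hu : X.IsSource u) (hu' : Y.IsSource u') (hw : X.wt u = Y.wt u')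
    {x₁ x₂ : X.V} {y : Y.V} (h₁ : Paired X Y u u' x₁ y) (h₂ : Paired X Y u u' x₂ y) :
    x₁ = x₂ := by
  induction hn : (Y.height y).toNat using Nat.strong_induction_on generalizing x₁ x₂ y with
  | _ n ih =>
    by_cases hy : Y.IsSource y
    · rw [(h₁.eq_of_isSource hY hy).1, (h₂.eq_of_isSource hY hy).1]
    · simp only [IsSource, not_forall] at hy
      obtain ⟨i, hi⟩ := hy
      obtain ⟨y', hy'⟩ := Option.ne_none_iff_exists'.1 hi
      obtain ⟨a₁, ha₁, p₁⟩ := (h₁.symm.lift hr hY hX hu' hu hw.symm i).1 y' hy'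
      obtain ⟨a₂, ha₂, p₂⟩ := (h₂.symm.lift hr hY hX hu' hu hw.symm i).1 y' hy'
      have hh := hY.height_e hr hy'
      have hnn := hY.degree.height_nonneg y'
      have := ih _ (by omega) p₁.symm p₂.symm rfl
      subst this
      exact Option.some_inj.1 ((hX.f_iff.2 ha₁).symm.trans (hX.f_iff.2 ha₂))

/-- A vertex which is linked to the base point is the second entry of a pair. -/
theorem Paired.exists_of_linked (hr : 1 ≤ r) (hX : X.IsConfluent) (hY : Y.IsConfluent)
    (hu : X.IsSource u) (hu' : Y.IsSource u') (hw : X.wt u = Y.wt u')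
    {y : Y.V} (h : Y.Linked u' y) : ∃ x, Paired X Y u u' x y := by
  have key : ∀ y₁ y₂, Y.Linked y₁ y₂ →
      ((∃ x, Paired X Y u u' x y₁) ↔ ∃ x, Paired X Y u u' x y₂) := by
    intro y₁ y₂ h
    induction h with
    | rel a b hab =>
      obtain ⟨i, hi⟩ := hab
      constructor
      · rintro ⟨x, hx⟩
        obtain ⟨x', -, hp⟩ := (hx.symm.lift hr hY hX hu' hu hw.symm i).2 b hi
        exact ⟨x', hp.symm⟩
      · rintro ⟨x, hx⟩
        obtain ⟨x', -, hp⟩ := (hx.symm.lift hr hY hX hu' hu hw.symm i).1 a (hY.f_iff.1 hi)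
        exact ⟨x', hp.symm⟩
    | refl => exact Iff.rfl
    | symm _ _ _ ih => exact ih.symm
    | trans _ _ _ _ _ ih1 ih2 => exact ih1.trans ih2
  exact (key _ _ h).1 ⟨u, .base⟩

theorem Paired.linked {x : X.V} {y : Y.V} (h : Paired X Y u u' x y) : X.Linked u x := by
  induction h with
  | base => exact .refl _
  | step _ h1 _ ih => exact ih.trans _ _ _ (.rel _ _ ⟨_, h1⟩)

/-- A connected confluent graph is determined by the weight of a source. -/
theorem IsConfluent.nonempty_iso (hr : 1 ≤ r) (hX : X.IsConfluent) (hY : Y.IsConfluent)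
    (hu : X.IsSource u) (hu' : Y.IsSource u') (hw : X.wt u = Y.wt u') (hconn : Y.IsConnected)
    {b : X.V} (hb : X.Linked b u) : Nonempty (Y.Iso (X.component b)) := by
  -- The isomorphism sends `y` to its partner. Uniqueness of partners on both sides gives
  -- bijectivity and compatibility with the operators.
  choose g hg using fun y => Paired.exists_of_linked hr hX hY hu hu' hw (hconn.2 u' y)
  have hlink : ∀ y, X.Linked b (g y) := fun y => hb.trans _ _ _ (hg y).linked
  let G : Y.V → (X.component b).V := fun y => ⟨g y, hlink y⟩
  have hG : Function.Bijective G := by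
    constructor
    · intro y₁ y₂ h
      have h' : g y₁ = g y₂ := congrArg Subtype.val h
      have p₁ := (hg y₁).symm
      rw [h'] at p₁
      exact p₁.left_unique hr hY hX hu' hu hw.symm (hg y₂).symm
    · rintro ⟨x, hx⟩
      obtain ⟨y, hy⟩ := Paired.exists_of_linked hr hY hX hu' hu hw.symm
        ((hb.symm _ _).trans _ _ _ hx)
      exact ⟨y, Subtype.ext ((hg y).left_unique hr hX hY hu hu' hw hy.symm)⟩
  refine ⟨⟨Equiv.ofBijective G hG, fun i y => ?_, fun i y => ?_, fun y =>
    (hg y).wt_eq hX.toIsWeightedGraph hY.toIsWeightedGraph hw⟩⟩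
  · change (X.e i (g y)).bind _ = (Y.e i y).map G
    cases hy : Y.e i y with
    | none =>
      cases hx : X.e i (g y) with
      | none => rfl
      | some x' =>
        obtain ⟨y', hy', -⟩ := ((hg y).lift hr hX hY hu hu' hw i).1 x' hx
        simp [hy] at hy'
    | some y' =>
      obtain ⟨x', hx', hp⟩ := ((hg y).symm.lift hr hY hX hu' hu hw.symm i).1 y' hy
      have hgy := (hg y').left_unique hr hX hY hu hu' hw hp.symm
      subst hgy
      rw [hx']
      exact dif_pos (hlink y')
  · change (X.f i (g y)).bind _ = (Y.f i y).map G
    cases hy : Y.f i y with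
    | none =>
      cases hx : X.f i (g y) with
      | none => rfl
      | some x' =>
        obtain ⟨y', hy', -⟩ := ((hg y).lift hr hX hY hu hu' hw i).2 x' hx
        simp [hy] at hy'
    | some y' =>
      obtain ⟨x', hx', hp⟩ := ((hg y).symm.lift hr hY hX hu' hu hw.symm i).2 y' hy
      have hgy := (hg y').left_unique hr hX hY hu hu' hw hp.symm
      subst hgy
      rw [hx']
      exact dif_pos (hlink y')

/-- Pair the graph with itself: every vertex occurs in a pair, but a source only in the base pair.
-/
theorem IsConfluent.eq_of_isSource (hr : 1 ≤ r) (hY : Y.IsConfluent) (hu' : Y.IsSource u')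
    (hconn : Y.IsConnected) {y : Y.V} (hy : Y.IsSource y) : y = u' := by
  obtain ⟨x, hx⟩ := Paired.exists_of_linked hr hY hY hu' hu' rfl (hconn.2 u' y)
  exact (hx.eq_of_isSource hY hy).2

/-- Without a source one could raise forever, while the nonnegative height drops. -/
theorem IsConfluent.exists_isSource (hr : 1 ≤ r) (hY : Y.IsConfluent) (hne : Nonempty Y.V) :
    ∃ y, Y.IsSource y := by
  by_contra! h
  have key : ∀ n : ℕ, ∀ y, Y.height y < n → False := by
    intro n
    induction n with
    | zero => exact fun y hy => absurd hy (by simpa using hY.degree.height_nonneg y)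
    | succ n ih =>
      intro y hy
      have := h y
      simp only [IsSource, not_forall] at this
      obtain ⟨i, hi⟩ := this
      obtain ⟨y', hy'⟩ := Option.ne_none_iff_exists'.1 hi
      have hh := hY.height_e hr hy'
      exact ih y' (by push_cast at hy; omega)
  obtain ⟨y⟩ := hne
  refine key ((Y.height y).toNat + 1) y ?_
  push_cast
  have := Int.self_le_toNat (Y.height y)
  omega

end Rigid

/-! ### Regular queer graphs of degree three are confluent -/

theorem eWord_two (Y : QueerGraph.{u} r) (i j : Fin (r + 1)) (x : Y.V) :
    Y.eWord [i, j] x = (Y.e j x).bind (Y.e i) := by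
  simp [eWord]

theorem fWord_two (Y : QueerGraph.{u} r) (i j : Fin (r + 1)) (x : Y.V) :
    Y.fWord [i, j] x = (Y.f j x).bind (Y.f i) := by
  simp [fWord]

theorem eWord_four (Y : QueerGraph.{u} r) (i j k l : Fin (r + 1)) (x : Y.V) :
    Y.eWord [i, j, k, l] x = (((Y.e l x).bind (Y.e k)).bind (Y.e j)).bind (Y.e i) := by
  simp [eWord, Option.bind_assoc]

theorem fWord_four (Y : QueerGraph.{u} r) (i j k l : Fin (r + 1)) (x : Y.V) :
    Y.fWord [i, j, k, l] x = (((Y.f l x).bind (Y.f k)).bind (Y.f j)).bind (Y.f i) := by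
  simp [fWord, Option.bind_assoc]

namespace IsRegularQueer

variable {Y : QueerGraph.{u} r} (h : Y.IsRegularQueer)

include h

theorem iter_e_zero (x : Y.V) : iter (Y.e 0) 2 x = none := by
  by_contra hne
  obtain ⟨z, hz⟩ := Option.ne_none_iff_exists'.1 hne
  simp only [iter, Option.bind_some, Option.bind_eq_some_iff] at hz
  obtain ⟨y, hy, hz⟩ := hz
  have := h.B1_length z
  rw [iter, iter, iter, Option.bind_some, h.f_iff.2 hz, Option.bind_some, h.f_iff.2 hy] at this
  simp at this

theorem length_e (i : Fin (r + 1)) : IsLength (Y.e i) (Y.eps i) := by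
  refine isLength_of_finite fun x => ?_
  by_cases hi : i = 0
  · subst hi
    exact ⟨2, h.iter_e_zero x⟩
  · exact (h.B0.A1 i hi x).1

theorem length_f (i : Fin (r + 1)) : IsLength (Y.f i) (Y.phi i) := by
  refine isLength_of_finite fun x => ?_
  by_cases hi : i = 0
  · subst hi
    exact ⟨2, h.B1_length x⟩
  · exact (h.B0.A1 i hi x).2

/-- Two nonpositive integers with sum 0 or -1 leave only these values. They separate the square
axiom from the hexagon axiom. -/
theorem delta_eps_cases {i j : Fin (r + 1)} (hi : i ≠ 0) (hj : j ≠ 0) (hij : i ≠ j) {x a : Y.V}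
    (ha : Y.e i x = some a) : Y.DeltaEps i j x 0 ∨ Y.DeltaEps i j x (-1) := by
  have h1 := h.B0.A3 i j hi hj x _ _ ⟨a, ha, rfl⟩ ⟨a, ha, rfl⟩
  have h2 := h.B0.A4 i j hi hj hij x _ _ ⟨a, ha, rfl⟩ ⟨a, ha, rfl⟩
  rw [if_neg hij] at h1
  rcases (by split_ifs at h1 <;> omega :
    (Y.eps j x : ℤ) - Y.eps j a = 0 ∨ (Y.eps j x : ℤ) - Y.eps j a = -1) with h3 | h3
  · exact .inl ⟨a, ha, h3⟩
  · exact .inr ⟨a, ha, h3⟩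

theorem up_square {i j : Fin (r + 1)} (hi : i ≠ 0) (hj : j ≠ 0) (hij : i ≠ j) {x a b : Y.V}
    (ha : Y.e i x = some a) (hb : Y.e j x = some b) (hd : Y.DeltaEps i j x 0) :
    ∃ w, Y.e j a = some w ∧ Y.e i b = some w ∧ Y.phi i w = Y.phi i a := by
  obtain ⟨w, h1, h2, x', h3, h4⟩ := h.B0.A5_up i j hi hj hij x (by simp [hb]) hd
  rw [eWord_two, hb, Option.bind_some] at h1
  rw [eWord_two, ha, Option.bind_some] at h2
  obtain rfl : x' = a := Option.some_inj.1 (h3.symm.trans (h.f_iff.2 h2))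
  exact ⟨w, h2, h1, by omega⟩

/-- If either difference is 0 there is a square; if both are -1 there is a hexagon. The recorded
values of `φ` at the top are the ones that trigger the dual axiom in another graph. -/
theorem up {i j : Fin (r + 1)} (hi : i ≠ 0) (hj : j ≠ 0) (hij : i ≠ j) {x a b : Y.V}
    (ha : Y.e i x = some a) (hb : Y.e j x = some b) :
    (∃ w, Y.e j a = some w ∧ Y.e i b = some w ∧
      (Y.phi i w = Y.phi i a ∨ Y.phi j w = Y.phi j b)) ∨
    ∃ a₁ a₂ b₁ b₂ w, Y.e j a = some a₁ ∧ Y.e j a₁ = some a₂ ∧ Y.e i a₂ = some w ∧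
      Y.e i b = some b₁ ∧ Y.e i b₁ = some b₂ ∧ Y.e j b₂ = some w ∧
      Y.phi j a₂ = Y.phi j w + 1 ∧ Y.phi i b₂ = Y.phi i w + 1 := by
  rcases h.delta_eps_cases hi hj hij ha with h1 | h1
  · obtain ⟨w, h1, h2, h3⟩ := h.up_square hi hj hij ha hb h1
    exact .inl ⟨w, h1, h2, .inl h3⟩
  rcases h.delta_eps_cases hj hi (Ne.symm hij) hb with h2 | h2
  · obtain ⟨w, h1, h2, h3⟩ := h.up_square hj hi (Ne.symm hij) hb ha h2
    exact .inl ⟨w, h2, h1, .inr h3⟩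
  · obtain ⟨w, h3, h4, ⟨a₂', h5, h6⟩, b₂', h7, h8⟩ := h.B0.A6_up i j hi hj hij x h1 h2
    rw [eWord_four, ha, Option.bind_some] at h3
    rw [eWord_four, hb, Option.bind_some] at h4
    simp only [Option.bind_eq_some_iff] at h3 h4
    obtain ⟨a₂, ⟨a₁, g1, g2⟩, g3⟩ := h3
    obtain ⟨b₂, ⟨b₁, k1, k2⟩, k3⟩ := h4
    obtain rfl : a₂' = a₂ := Option.some_inj.1 (h5.symm.trans (h.f_iff.2 g3))
    obtain rfl : b₂' = b₂ := Option.some_inj.1 (h7.symm.trans (h.f_iff.2 k3))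
    exact .inr ⟨a₁, a₂', b₁, b₂', w, g1, g2, g3, k1, k2, k3, by omega, by omega⟩

theorem down_square {i j : Fin (r + 1)} (hi : i ≠ 0) (hj : j ≠ 0) (hij : i ≠ j) {w a b : Y.V}
    (hb : Y.f i w = some b) (ha : Y.f j w = some a) (hp : Y.phi i w = Y.phi i a) :
    ∃ x, Y.f i a = some x ∧ Y.f j b = some x := by
  obtain ⟨x, h1, h2, -⟩ := h.B0.A5_down j i hj hi (Ne.symm hij) w (by simp [hb])
    ⟨a, ha, by omega⟩
  rw [fWord_two, hb, Option.bind_some] at h1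
  rw [fWord_two, ha, Option.bind_some] at h2
  exact ⟨x, h2, h1⟩

theorem down_hexagon {i j : Fin (r + 1)} (hi : i ≠ 0) (hj : j ≠ 0) (hij : i ≠ j) {w a₂ b₂ : Y.V}
    (ha : Y.f i w = some a₂) (hb : Y.f j w = some b₂) (hpa : Y.phi j a₂ = Y.phi j w + 1)
    (hpb : Y.phi i b₂ = Y.phi i w + 1) :
    ∃ a₁ a b₁ b x, Y.f j a₂ = some a₁ ∧ Y.f j a₁ = some a ∧ Y.f i a = some x ∧
      Y.f i b₂ = some b₁ ∧ Y.f i b₁ = some b ∧ Y.f j b = some x := by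
  obtain ⟨x, h1, h2, -, -⟩ := h.B0.A6_down i j hi hj hij w ⟨a₂, ha, by omega⟩ ⟨b₂, hb, by omega⟩
  rw [fWord_four, ha, Option.bind_some] at h1
  rw [fWord_four, hb, Option.bind_some] at h2
  simp only [Option.bind_eq_some_iff] at h1 h2
  obtain ⟨a, ⟨a₁, g1, g2⟩, g3⟩ := h1
  obtain ⟨b, ⟨b₁, k1, k2⟩, k3⟩ := h2
  exact ⟨a₁, a, b₁, b, x, g1, g2, g3, k1, k2, k3⟩

theorem zero_down {i : Fin (r + 1)} (hi : 2 ≤ (i : ℕ)) {w a b : Y.V} (ha : Y.f 0 w = some a)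
    (hb : Y.f i w = some b) : Y.f i a = Y.f 0 b := by
  have := h.B5_down i hi b a w (h.f_iff.1 hb) (h.f_iff.1 ha)
  rwa [fWord_two, fWord_two, ha, hb, Option.bind_some, Option.bind_some] at this

theorem zero_far {i : Fin (r + 1)} (hi : 3 ≤ (i : ℕ)) {x a : Y.V} (ha : Y.e 0 x = some a) :
    Y.phi i a = Y.phi i x ∧ Y.eps i a = Y.eps i x := by
  have := h.B4_ge i hi x _ _ ⟨a, ha, rfl⟩ ⟨a, ha, rfl⟩
  omega

theorem zero_up {i : Fin (r + 1)} (hi : (i : ℕ) = 1 ∨ 3 ≤ (i : ℕ)) {x a b : Y.V}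
    (ha : Y.e 0 x = some a) (hb : Y.e i x = some b) (hab : a ≠ b) : Y.e i a = Y.e 0 b := by
  have := h.B5_up i hi b a x (h.f_iff.2 hb) (h.f_iff.2 ha) (Ne.symm hab)
  rwa [eWord_two, eWord_two, ha, hb, Option.bind_some, Option.bind_some] at this

/-- Only `e_0` changes coordinate 0, so `a ≠ b` and (B5) applies. That `e_i a` is defined follows
from the invariance of `ε_i` under `e_0`. -/
theorem zero_far_up {i : Fin (r + 1)} (hi : 3 ≤ (i : ℕ)) {x a b : Y.V} (ha : Y.e 0 x = some a)
    (hb : Y.e i x = some b) : ∃ w, Y.e i a = some w ∧ Y.e 0 b = some w := by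
  have hi0 : i ≠ 0 := fun hh => by simp [hh] at hi
  have v1 := val_one (r := r) (by have := i.2; omega)
  have h01 : (0 : Fin (r + 1)) ≠ 1 := fun hh => by simp [← hh] at v1
  have hi1 : (0 : Fin (r + 1)) ≠ i - 1 := fun hh => by
    have := val_sub_one hi0
    rw [← hh, Fin.val_zero] at this
    omega
  have hab : a ≠ b := by
    rintro rfl
    have h1 := h.wt_e_zero ha 0
    have h2 := h.wt_e hi0 hb 0
    simp only [if_true, if_neg h01, if_neg hi0.symm, if_neg hi1] at h1 h2
    omega
  have h1 := (h.length_e i).pos hb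
  rw [← (h.zero_far hi ha).2] at h1
  obtain ⟨w, hw⟩ := (h.length_e i).exists_of_pos h1
  exact ⟨w, hw, by rw [← h.zero_up (.inr hi) ha hb hab, hw]⟩

/-- The changes of the string lengths of colour `1` along an edge of colour `0`. -/
theorem zero_one_lengths {i : Fin (r + 1)} (hi : (i : ℕ) = 1) {x a : Y.V}
    (ha : Y.e 0 x = some a) :
    (Y.eps i x = Y.eps i a + 1 ∧ Y.phi i x = 0 ∧ Y.phi i a = 1 ∧ Y.e i x = some a) ∨
    (Y.eps i x = Y.eps i a ∧ Y.phi i a = Y.phi i x + 2) := by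
  -- The differences have sum 2, the first is nonnegative and the second positive: they are `(1,
  -- 1)`, which (B6) describes, or `(0, 2)`.
  have h1 := h.B3 i x _ _ ⟨a, ha, rfl⟩ ⟨a, ha, rfl⟩
  have h2 := h.B4_one i hi x _ _ ⟨a, ha, rfl⟩ ⟨a, ha, rfl⟩
  rw [if_pos (by omega)] at h1
  by_cases h3 : (Y.eps i x : ℤ) - Y.eps i a = 1
  · have h4 := h.B6_one i hi x ⟨a, ha, h3⟩
    exact .inl ⟨by omega, h4.1, by omega, h4.2.trans ha⟩
  · exact .inr (by omega)

theorem zero_one {i : Fin (r + 1)} (hi : (i : ℕ) = 1) {w a : Y.V} (ha : Y.f 0 w = some a) :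
    0 < Y.phi i w ∧ (Y.f i w = some a ↔ Y.phi i w = 1) := by
  rcases h.zero_one_lengths hi (h.f_iff.1 ha) with ⟨h1, h2, h3, h4⟩ | ⟨h1, h2⟩
  · exact ⟨by omega, fun _ => h3, fun _ => h.f_iff.2 h4⟩
  · refine ⟨by omega, fun h3 => ?_, fun h3 => by omega⟩
    have := (h.length_e i a).2 w (h.f_iff.1 h3)
    omega

variable (hd : Y.HasDegree 3)

include hd

/-- Distinct edges force `φ_1(a) = φ_1(x) + 2`, so `φ_1` is at least 3 at the top. It is at most 3
because the degree bounds each coordinate. -/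
theorem zero_one_up {i : Fin (r + 1)} (hi : (i : ℕ) = 1) {x a b : Y.V} (ha : Y.e 0 x = some a)
    (hb : Y.e i x = some b) (hab : a ≠ b) :
    ∃ w, Y.e i a = some w ∧ Y.e 0 b = some w ∧ Y.phi i w = 3 := by
  have hi0 : i ≠ 0 := fun hh => by simp [hh] at hi
  rcases h.zero_one_lengths hi ha with ⟨-, -, -, h4⟩ | ⟨h1, h2⟩
  · exact absurd (Option.some_inj.1 (h4.symm.trans hb)) hab
  · have h3 := (h.length_e i).pos hb
    rw [h1] at h3
    obtain ⟨w, hw⟩ := (h.length_e i).exists_of_pos h3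
    have h4 := (h.length_f i w).2 a (h.f_iff.2 hw)
    have h5 := h.phi_le hd (h.length_f i) hi0 w
    have h6 : Y.wt w (i - 1) ≤ 3 := by
      rw [← (hd w).2]
      exact Finset.single_le_sum (fun j _ => (hd w).1 j) (Finset.mem_univ _)
    exact ⟨w, hw, by rw [← h.zero_up (.inl hi) ha hb hab, hw], by omega⟩

/-- The axiom (B5) for colour 1 completes squares upwards only. The hypothesis forces `w` to have
weight `(3, 0, …)`, so `s = f_1 q` ends its 1-string. Hence `f_0 s` is undefined and `e_0 s` is
defined, and (B5) at `s` identifies `e_0 s` with `p`. -/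
theorem zero_one_down {i : Fin (r + 1)} (hi : (i : ℕ) = 1) {w q p : Y.V} (hq : Y.f 0 w = some q)
    (hp : Y.f i w = some p) (hw : Y.phi i w = 3) :
    ∃ x, Y.f i q = some x ∧ Y.f 0 p = some x := by
  have hi0 : i ≠ 0 := fun hh => by simp [hh] at hi
  have hi1 : i = 1 := Fin.ext (hi.trans (val_one (by have := i.2; omega)).symm)
  have hii : i - 1 = 0 := by rw [hi1, sub_self]
  have phi_le := h.phi_le hd (h.length_f i) hi0
  have hsum : ∑ j ∈ ({0, i} : Finset (Fin (r + 1))), Y.wt w j ≤ 3 := by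
    rw [← (hd w).2]
    exact Finset.sum_le_univ_sum_of_nonneg (hd w).1
  rw [Finset.sum_pair hi0.symm] at hsum
  have w1 := (hd w).1 i
  have wq := h.wt_e_zero (h.f_iff.1 hq)
  have wq0 := wq 0
  have wq1 := wq i
  rw [← hi1] at wq0 wq1
  simp only [if_true, if_neg hi0, if_neg hi0.symm] at wq0 wq1
  have pw := phi_le w
  have pq := phi_le q
  rw [hii] at pw pq
  have sw := h.string i hi0 w
  have sq := h.string i hi0 q
  rw [hii] at sw sq
  rcases h.zero_one_lengths hi (h.f_iff.1 hq) with ⟨h1, h2, h3, h4⟩ | ⟨h1, h2⟩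
  · omega
  obtain ⟨s, hs⟩ := (h.length_f i).exists_of_pos (x := q) (by omega)
  have ws := h.wt_e hi0 (h.f_iff.1 hs)
  have ws0 := ws 0
  have ws1 := ws i
  rw [hii] at ws0 ws1
  simp only [if_true, if_neg hi0, if_neg hi0.symm] at ws0 ws1
  have ps := (h.length_f i q).2 s hs
  have hlen := (h.B1_wt s).2 (by rw [← hi1]; omega)
  have hphi : Y.phi 0 s = 0 := by
    by_contra hne
    obtain ⟨t, ht⟩ := (h.length_f 0).exists_of_pos (Nat.pos_of_ne_zero hne)
    have := (h.zero_one hi ht).1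
    omega
  obtain ⟨t, ht⟩ := (h.length_e 0).exists_of_pos (x := s) (by omega)
  -- Equality would give the 0-path `w → q → s` of length two.
  have htq : t ≠ q := by
    rintro rfl
    have := h.B1_length w
    rw [iter, iter, iter, Option.bind_some, hq, Option.bind_some, h.f_iff.2 ht] at this
    simp at this
  have := h.zero_up (.inl hi) ht (h.f_iff.1 hs) htq
  rw [h.f_iff.1 hq, ← h.f_iff, hp] at this
  obtain rfl := Option.some_inj.1 this
  exact ⟨s, hs, h.f_iff.2 ht⟩

theorem isConfluent : Y.IsConfluent where
  toIsWeightedGraph := h.toIsWeightedGraph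
  length_e := h.length_e
  length_f := h.length_f
  degree := hd
  zero_length x hx := (h.B1_wt x).2 hx
  up _ _ hi hj hij _ _ _ ha hb := h.up hi hj hij ha hb
  down_square _ _ hi hj hij _ _ _ := h.down_square hi hj hij
  down_hexagon _ _ hi hj hij _ _ _ := h.down_hexagon hi hj hij
  zero_down _ hi _ _ _ := h.zero_down hi
  zero_far_phi _ hi _ _ ha := (h.zero_far hi (h.f_iff.1 ha)).1.symm
  zero_far_up _ hi _ _ _ := h.zero_far_up hi
  zero_one _ hi _ _ := h.zero_one hi
  zero_one_up _ hi _ _ _ := h.zero_one_up hd hi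
  zero_one_down _ hi _ _ _ := h.zero_one_down hd hi

end IsRegularQueer

/-! ### Regular queer graphs are queer crystals -/

namespace IsRegularQueer

variable {Y : QueerGraph.{u} r} (h : Y.IsRegularQueer) {i : Fin (r + 1)} (hi : 3 ≤ (i : ℕ))

include h hi

theorem comm_ef {x a b : Y.V} (ha : Y.e 0 x = some a) (hb : Y.f i x = some b) :
    ∃ w, Y.f i a = some w ∧ Y.e 0 b = some w := by
  have h1 := (h.length_f i).pos hb
  rw [← (h.zero_far hi ha).1] at h1
  obtain ⟨w, hw⟩ := (h.length_f i).exists_of_pos h1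
  have := h.zero_down (by omega) (h.f_iff.2 ha) hw
  rw [hb] at this
  exact ⟨w, hw, h.f_iff.1 this.symm⟩

theorem comm_fe {x a b : Y.V} (ha : Y.f 0 x = some a) (hb : Y.e i x = some b) :
    ∃ w, Y.e i a = some w ∧ Y.f 0 b = some w := by
  have ha' := h.f_iff.1 ha
  have h1 := (h.length_e i).pos hb
  rw [(h.zero_far hi ha').2] at h1
  obtain ⟨w, hw⟩ := (h.length_e i).exists_of_pos h1
  obtain ⟨v, hv1, hv2⟩ := h.zero_far_up hi ha' hw
  obtain rfl : b = v := Option.some_inj.1 (hb.symm.trans hv1)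
  exact ⟨w, hw, h.f_iff.2 hv2⟩

theorem comm_ff {x a b : Y.V} (ha : Y.f 0 x = some a) (hb : Y.f i x = some b) :
    ∃ w, Y.f i a = some w ∧ Y.f 0 b = some w := by
  have h1 := (h.length_f i).pos hb
  rw [(h.zero_far hi (h.f_iff.1 ha)).1] at h1
  obtain ⟨w, hw⟩ := (h.length_f i).exists_of_pos h1
  exact ⟨w, hw, by rw [← h.zero_down (by omega) ha hb, hw]⟩

omit hi in
-- Each commutation identity of partial operators splits into two implications. After reversing
-- edges, the eight implications are instances of `zero_far_up`, `comm_ef`, `comm_fe` and `comm_ff`,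
-- each used twice.
theorem isQueerCrystal (hne : Nonempty Y.V) : Y.IsQueerCrystal where
  toIsWeightedGraph := h.toIsWeightedGraph
  nonempty := hne
  finite := h.B0.A1
  strings i hi x y hxy := h.zero_far hi hxy
  comm i hi x := by
    refine ⟨Option.ext fun w => ?_, Option.ext fun w => ?_, Option.ext fun w => ?_,
      Option.ext fun w => ?_⟩ <;>
    simp only [Option.bind_eq_some_iff] <;>
    constructor <;>
    rintro ⟨b, hb, hw⟩
    · obtain ⟨a, h1, h2⟩ := h.comm_ef hi hw (h.f_iff.2 hb)
      exact ⟨a, h2, h.f_iff.1 h1⟩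
    · obtain ⟨a, h1, h2⟩ := h.comm_fe hi (h.f_iff.2 hb) hw
      exact ⟨a, h1, h.f_iff.1 h2⟩
    · obtain ⟨a, h1, h2⟩ := h.zero_far_up hi hw (h.f_iff.1 hb)
      exact ⟨a, h2, h.f_iff.2 h1⟩
    · obtain ⟨a, h1, h2⟩ := h.comm_ff hi (h.f_iff.2 hb) hw
      exact ⟨a, h1, h.f_iff.1 h2⟩
    · obtain ⟨a, h1, h2⟩ := h.comm_ff hi hw (h.f_iff.2 hb)
      exact ⟨a, h2, h.f_iff.1 h1⟩
    · obtain ⟨a, h1, h2⟩ := h.zero_far_up hi (h.f_iff.1 hb) hw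
      exact ⟨a, h1, h.f_iff.2 h2⟩
    · obtain ⟨a, h1, h2⟩ := h.comm_fe hi hw (h.f_iff.1 hb)
      exact ⟨a, h2, h.f_iff.2 h1⟩
    · obtain ⟨a, h1, h2⟩ := h.comm_ef hi (h.f_iff.1 hb) hw
      exact ⟨a, h1, h.f_iff.2 h2⟩

end IsRegularQueer

/-! ### Words of length three -/

namespace Word

/-- Words of length three, in the shape of a threefold tensor power. -/
abbrev W (A : Type*) := ((Unit × A) × A) × A

variable {A : Type*} [DecidableEq A]

/-- The indicator function of a letter. -/
def ind (p a : A) : ℕ := if a = p then 1 else 0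

/-- The number of unpaired letters `p` in a word of length two. -/
def phi₂ (p q a b : A) : ℕ := ind p b + (ind p a - ind q b)

/-- The number of unpaired letters `p`, where `p q` are brackets. -/
def phi (p q : A) : W A → ℕ := fun ((((), a), b), c) => ind p c + (phi₂ p q a b - ind q c)

/-- The number of unpaired letters `q`, where `p q` are brackets. -/
def eps (p q : A) : W A → ℕ := fun ((((), a), b), c) =>
  ind q a + (ind q b - ind p a) + (ind q c - phi₂ p q a b)

/-- Changes the first unpaired `p` to `q`. -/
def f (p q : A) : W A → Option (W A) := fun ((((), a), b), c) =>
  if ind q c < phi₂ p q a b then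
    if ind q b < ind p a then if a = p then some ((((), q), b), c) else none
    else if b = p then some ((((), a), q), c) else none
  else if c = p then some ((((), a), b), q) else none

/-- Changes the last unpaired `q` to `p`. -/
def e (p q : A) : W A → Option (W A) := fun ((((), a), b), c) =>
  if ind q c ≤ phi₂ p q a b then
    if ind q b ≤ ind p a then if a = q then some ((((), p), b), c) else none
    else if b = q then some ((((), a), p), c) else none
  else if c = q then some ((((), a), b), p) else none

/-- Changes the last letter among `p, q` to `q` if it is `p`. -/
def f₀ (p q : A) : W A → Option (W A) := fun ((((), a), b), c) =>
  if c ≠ p ∧ c ≠ q then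
    if b ≠ p ∧ b ≠ q then if a = p then some ((((), q), b), c) else none
    else if b = p then some ((((), a), q), c) else none
  else if c = p then some ((((), a), b), q) else none

/-- Changes the last letter among `p, q` to `p` if it is `q`. -/
def e₀ (p q : A) : W A → Option (W A) := fun ((((), a), b), c) =>
  if c ≠ p ∧ c ≠ q then
    if b ≠ p ∧ b ≠ q then if a = q then some ((((), p), b), c) else none
    else if b = q then some ((((), a), p), c) else none
  else if c = q then some ((((), a), b), p) else none

/-! ### Reduction to finitely many words

A word is compared with a word in the alphabet `Option (Fin n)`, in which `some i` stands for the
letter `l i` and `none` stands for all other letters. -/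

variable {n : ℕ} {l : Fin n → A}

/-- The letter `a` is represented by `t`; the letter `z` is represented by `none`. -/
def OverLetter (l : Fin n → A) (z a : A) : Option (Fin n) → Prop
  | none => a = z ∧ ∀ i, a ≠ l i
  | some i => a = l i

omit [DecidableEq A] in
theorem OverLetter.iff (hl : Function.Injective l) {z a : A} {t : Option (Fin n)}
    (h : OverLetter l z a t) (i : Fin n) : a = l i ↔ t = some i := by
  cases t with
  | none => simpa using h.2 i
  | some j =>
    have h' : a = l j := h
    rw [h', Option.some_inj]
    exact hl.eq_iff

theorem OverLetter.ind_eq (hl : Function.Injective l) {z a : A} {t : Option (Fin n)}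
    (h : OverLetter l z a t) (i : Fin n) : ind (l i) a = ind (some i) t := by
  simp only [ind, h.iff hl]

omit [DecidableEq A] in
-- This is the purpose of the reference letter `z`: the operators never alter a letter outside `l`,
-- so the merged symbol `none` can be decoded.
theorem OverLetter.unique {z a b : A} {t : Option (Fin n)}
    (h : OverLetter l z a t) (h' : OverLetter l z b t) : a = b := by
  cases t with
  | none => exact h.1.trans h'.1.symm
  | some j => exact (show a = l j from h).trans (show b = l j from h').symm

omit [DecidableEq A] in
theorem OverLetter.right_unique (hl : Function.Injective l) {z a : A} {t t' : Option (Fin n)}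
    (h : OverLetter l z a t) (h' : OverLetter l z a t') : t = t' :=
  Option.ext fun i => by rw [← h.iff hl i, ← h'.iff hl i]

theorem OverLetter.exists (l : Fin n → A) (a : A) : ∃ t, OverLetter l a a t := by
  by_cases h : ∃ i, a = l i
  · exact ⟨some h.choose, h.choose_spec⟩
  · exact ⟨none, rfl, not_exists.1 h⟩

/-- The word `x` is represented by `m`; other letters than the `l i` are those of `z`. -/
def Over (l : Fin n → A) (z x : W A) (m : W (Option (Fin n))) : Prop :=
  OverLetter l z.1.1.2 x.1.1.2 m.1.1.2 ∧ OverLetter l z.1.2 x.1.2 m.1.2 ∧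
    OverLetter l z.2 x.2 m.2

theorem Over.exists (l : Fin n → A) (x : W A) : ∃ m, Over l x x m := by
  obtain ⟨t₁, h₁⟩ := OverLetter.exists l x.1.1.2
  obtain ⟨t₂, h₂⟩ := OverLetter.exists l x.1.2
  obtain ⟨t₃, h₃⟩ := OverLetter.exists l x.2
  exact ⟨((((), t₁), t₂), t₃), h₁, h₂, h₃⟩

section Over

variable {z x y : W A} {m : W (Option (Fin n))}

omit [DecidableEq A] in
theorem Over.unique (hx : Over l z x m) (hy : Over l z y m) : x = y :=
  Prod.ext (Prod.ext (Prod.ext rfl (hx.1.unique hy.1)) (hx.2.1.unique hy.2.1))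
    (hx.2.2.unique hy.2.2)

omit [DecidableEq A] in
theorem Over.right_unique (hl : Function.Injective l) {m' : W (Option (Fin n))}
    (h : Over l z x m) (h' : Over l z x m') : m = m' :=
  Prod.ext (Prod.ext (Prod.ext rfl (h.1.right_unique hl h'.1)) (h.2.1.right_unique hl h'.2.1))
    (h.2.2.right_unique hl h'.2.2)

variable (hl : Function.Injective l) (h : Over l z x m) (i j : Fin n)

include hl h

theorem Over.phi_eq : phi (l i) (l j) x = phi (some i) (some j) m := by
  obtain ⟨h₁, h₂, h₃⟩ := h
  simp only [phi, phi₂, h₁.ind_eq hl, h₂.ind_eq hl, h₃.ind_eq hl]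

theorem Over.eps_eq : eps (l i) (l j) x = eps (some i) (some j) m := by
  obtain ⟨h₁, h₂, h₃⟩ := h
  simp only [eps, phi₂, h₁.ind_eq hl, h₂.ind_eq hl, h₃.ind_eq hl]

/-- The branch is chosen by comparisons with `l i` and `l j`, which the model sees, and the letter
that is written is itself one of the `l i`. -/
theorem Over.e_rel : Option.Rel (Over l z) (e (l i) (l j) x) (e (some i) (some j) m) := by
  obtain ⟨h₁, h₂, h₃⟩ := h
  simp only [e, phi₂, h₁.ind_eq hl, h₂.ind_eq hl, h₃.ind_eq hl, h₁.iff hl, h₂.iff hl, h₃.iff hl]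
  split_ifs
  exacts [.some ⟨rfl, h₂, h₃⟩, .none, .some ⟨h₁, rfl, h₃⟩, .none, .some ⟨h₁, h₂, rfl⟩, .none]

theorem Over.f_rel : Option.Rel (Over l z) (f (l i) (l j) x) (f (some i) (some j) m) := by
  obtain ⟨h₁, h₂, h₃⟩ := h
  simp only [f, phi₂, h₁.ind_eq hl, h₂.ind_eq hl, h₃.ind_eq hl, h₁.iff hl, h₂.iff hl, h₃.iff hl]
  split_ifs
  exacts [.some ⟨rfl, h₂, h₃⟩, .none, .some ⟨h₁, rfl, h₃⟩, .none, .some ⟨h₁, h₂, rfl⟩, .none]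

theorem Over.e₀_rel : Option.Rel (Over l z) (e₀ (l i) (l j) x) (e₀ (some i) (some j) m) := by
  obtain ⟨h₁, h₂, h₃⟩ := h
  simp only [e₀, ne_eq, h₁.iff hl, h₂.iff hl, h₃.iff hl]
  split_ifs
  exacts [.some ⟨rfl, h₂, h₃⟩, .none, .some ⟨h₁, rfl, h₃⟩, .none, .some ⟨h₁, h₂, rfl⟩, .none]

theorem Over.f₀_rel : Option.Rel (Over l z) (f₀ (l i) (l j) x) (f₀ (some i) (some j) m) := by
  obtain ⟨h₁, h₂, h₃⟩ := h
  simp only [f₀, ne_eq, h₁.iff hl, h₂.iff hl, h₃.iff hl]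
  split_ifs
  exacts [.some ⟨rfl, h₂, h₃⟩, .none, .some ⟨h₁, rfl, h₃⟩, .none, .some ⟨h₁, h₂, rfl⟩, .none]

end Over

theorem rel_some {B C : Type*} {R : B → C → Prop} {o : Option B} {o' : Option C}
    (h : Option.Rel R o o') {b : B} (hb : o = some b) : ∃ c, o' = some c ∧ R b c := by
  subst hb
  cases h with
  | some h => exact ⟨_, rfl, h⟩

theorem rel_some' {B C : Type*} {R : B → C → Prop} {o : Option B} {o' : Option C}
    (h : Option.Rel R o o') {c : C} (hc : o' = some c) : ∃ b, o = some b ∧ R b c := by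
  subst hc
  cases h with
  | some h => exact ⟨_, rfl, h⟩

theorem rel_none {B C : Type*} {R : B → C → Prop} {o : Option B} {o' : Option C}
    (h : Option.Rel R o o') (hb : o = none) : o' = none := by
  subst hb
  cases h
  rfl

omit [DecidableEq A] in
/-- If `x` and `y` reach a common word over the model, they reach a common word. -/
theorem common {z : W A} {o : Option (W A)} {o' : Option (W (Option (Fin n)))} {x : W A}
    {m : W (Option (Fin n))} (h : Option.Rel (Over l z) o o') (ho : o' = some m)
    (hx : Over l z x m) : o = some x := by
  obtain ⟨b, hb, h'⟩ := rel_some' h ho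
  rw [hb, h'.unique hx]

omit [DecidableEq A] in
theorem injective_two {p q : A} (hpq : p ≠ q) : Function.Injective ![p, q] := by
  intro i j
  fin_cases i <;> fin_cases j <;> simp [hpq, hpq.symm]

omit [DecidableEq A] in
theorem injective_three {p q s : A} (hpq : p ≠ q) (hqs : q ≠ s) (hps : p ≠ s) :
    Function.Injective ![p, q, s] := by
  intro i j
  fin_cases i <;> fin_cases j <;> simp [hpq, hpq.symm, hqs, hqs.symm, hps, hps.symm]

omit [DecidableEq A] in
theorem injective_four {p q s t : A} (hpq : p ≠ q) (hst : s ≠ t) (hps : p ≠ s) (hpt : p ≠ t)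
    (hqs : q ≠ s) (hqt : q ≠ t) : Function.Injective ![p, q, s, t] := by
  intro i j
  fin_cases i <;> fin_cases j <;> simp [hpq, hpq.symm, hqs, hqs.symm, hps, hps.symm, hst, hst.symm,
    hpt, hpt.symm, hqt, hqt.symm]

/-! ### One pair of letters -/

set_option synthInstance.maxHeartbeats 400000 in
set_option synthInstance.maxSize 4000 in
-- A check of the 27 words in two letters and one symbol for all others.
theorem model_length : ∀ x : W (Option (Fin 2)),
    (∀ y ∈ e (some 0) (some 1) x, f (some 0) (some 1) y = some x ∧
      eps (some 0) (some 1) x = eps (some 0) (some 1) y + 1) ∧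
    (∀ y ∈ f (some 0) (some 1) x, e (some 0) (some 1) y = some x ∧
      phi (some 0) (some 1) x = phi (some 0) (some 1) y + 1) ∧
    (e (some 0) (some 1) x = none → eps (some 0) (some 1) x = 0) ∧
    (f (some 0) (some 1) x = none → phi (some 0) (some 1) x = 0) := by
  decide +kernel

set_option synthInstance.maxHeartbeats 400000 in
set_option synthInstance.maxSize 4000 in
theorem model_zero : ∀ x : W (Option (Fin 2)),
    (∀ y ∈ e₀ (some 0) (some 1) x, f₀ (some 0) (some 1) y = some x ∧
      e₀ (some 0) (some 1) y = none) ∧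
    (∀ y ∈ f₀ (some 0) (some 1) x, e₀ (some 0) (some 1) y = some x ∧
      f₀ (some 0) (some 1) y = none) ∧
    (e₀ (some 0) (some 1) x = none ∨ f₀ (some 0) (some 1) x = none) := by
  decide +kernel

set_option synthInstance.maxHeartbeats 400000 in
set_option synthInstance.maxSize 4000 in
theorem model_zero_one : ∀ x : W (Option (Fin 2)),
    (∀ a ∈ f₀ (some 0) (some 1) x, 0 < phi (some 0) (some 1) x ∧
      (f (some 0) (some 1) x = some a ↔ phi (some 0) (some 1) x = 1)) ∧
    (∀ a ∈ e₀ (some 0) (some 1) x, ∀ b ∈ e (some 0) (some 1) x, a ≠ b →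
      ∃ w ∈ e (some 0) (some 1) a, e₀ (some 0) (some 1) b = some w ∧
        phi (some 0) (some 1) w = 3) ∧
    (∀ a ∈ f₀ (some 0) (some 1) x, ∀ b ∈ f (some 0) (some 1) x, phi (some 0) (some 1) x = 3 →
      ∃ w ∈ f (some 0) (some 1) a, f₀ (some 0) (some 1) b = some w) := by
  decide +kernel

section Two

variable {p q : A} (hpq : p ≠ q) {x y : W A}

include hpq

theorem e_iff_f : e p q x = some y ↔ f p q y = some x := by
  have hl := injective_two hpq
  constructor
  · intro h
    obtain ⟨m, hm⟩ := Over.exists ![p, q] x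
    obtain ⟨m', h1, h2⟩ := rel_some (hm.e_rel hl 0 1) h
    exact common (h2.f_rel hl 0 1) ((model_length m).1 m' h1).1 hm
  · intro h
    obtain ⟨m, hm⟩ := Over.exists ![p, q] y
    obtain ⟨m', h1, h2⟩ := rel_some (hm.f_rel hl 0 1) h
    exact common (h2.e_rel hl 0 1) ((model_length m).2.1 m' h1).1 hm

theorem e₀_iff_f₀ : e₀ p q x = some y ↔ f₀ p q y = some x := by
  have hl := injective_two hpq
  constructor
  · intro h
    obtain ⟨m, hm⟩ := Over.exists ![p, q] x
    obtain ⟨m', h1, h2⟩ := rel_some (hm.e₀_rel hl 0 1) h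
    exact common (h2.f₀_rel hl 0 1) ((model_zero m).1 m' h1).1 hm
  · intro h
    obtain ⟨m, hm⟩ := Over.exists ![p, q] y
    obtain ⟨m', h1, h2⟩ := rel_some (hm.f₀_rel hl 0 1) h
    exact common (h2.e₀_rel hl 0 1) ((model_zero m).2.1 m' h1).1 hm

theorem isLength_e : IsLength (e p q) (eps p q) := by
  have hl := injective_two hpq
  refine fun x => ⟨fun hx => ?_, fun y hy => ?_⟩
  all_goals obtain ⟨m, hm⟩ := Over.exists ![p, q] x
  · exact (hm.eps_eq hl 0 1).trans ((model_length m).2.2.1 (rel_none (hm.e_rel hl 0 1) hx))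
  · obtain ⟨m', h1, h2⟩ := rel_some (hm.e_rel hl 0 1) hy
    have := ((model_length m).1 m' h1).2
    rwa [← hm.eps_eq hl 0 1, ← h2.eps_eq hl 0 1] at this

theorem isLength_f : IsLength (f p q) (phi p q) := by
  have hl := injective_two hpq
  refine fun x => ⟨fun hx => ?_, fun y hy => ?_⟩
  all_goals obtain ⟨m, hm⟩ := Over.exists ![p, q] x
  · exact (hm.phi_eq hl 0 1).trans ((model_length m).2.2.2 (rel_none (hm.f_rel hl 0 1) hx))
  · obtain ⟨m', h1, h2⟩ := rel_some (hm.f_rel hl 0 1) hy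
    have := ((model_length m).2.1 m' h1).2
    rwa [← hm.phi_eq hl 0 1, ← h2.phi_eq hl 0 1] at this

end Two

end Word

namespace Word

variable {A : Type*} [DecidableEq A]

section Two

variable {p q : A} (hpq : p ≠ q) {x a b : W A}

include hpq

theorem e₀_e₀ (ha : e₀ p q x = some a) : e₀ p q a = none := by
  have hl := injective_two hpq
  obtain ⟨m, hm⟩ := Over.exists ![p, q] x
  obtain ⟨a', ha', hoa⟩ := rel_some (hm.e₀_rel hl 0 1) ha
  by_contra hne
  obtain ⟨y, hy⟩ := Option.ne_none_iff_exists'.1 hne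
  obtain ⟨m', hm', -⟩ := rel_some (hoa.e₀_rel hl 0 1) hy
  simp [((model_zero m).1 a' ha').2] at hm'

theorem f₀_f₀ (ha : f₀ p q x = some a) : f₀ p q a = none := by
  have hl := injective_two hpq
  obtain ⟨m, hm⟩ := Over.exists ![p, q] x
  obtain ⟨a', ha', hoa⟩ := rel_some (hm.f₀_rel hl 0 1) ha
  by_contra hne
  obtain ⟨y, hy⟩ := Option.ne_none_iff_exists'.1 hne
  obtain ⟨m', hm', -⟩ := rel_some (hoa.f₀_rel hl 0 1) hy
  simp [((model_zero m).2.1 a' ha').2] at hm'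

theorem f₀_eq_none (ha : e₀ p q x = some a) : f₀ p q x = none := by
  have hl := injective_two hpq
  obtain ⟨m, hm⟩ := Over.exists ![p, q] x
  obtain ⟨a', ha', -⟩ := rel_some (hm.e₀_rel hl 0 1) ha
  by_contra hne
  obtain ⟨y, hy⟩ := Option.ne_none_iff_exists'.1 hne
  obtain ⟨m', hm', -⟩ := rel_some (hm.f₀_rel hl 0 1) hy
  rcases (model_zero m).2.2 with h | h
  · simp [ha'] at h
  · simp [hm'] at h

omit hpq in
theorem f₀_ne_none (hx : x.1.1.2 = p ∨ x.1.1.2 = q ∨ x.1.2 = p ∨ x.1.2 = q ∨ x.2 = p ∨ x.2 = q)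
    (he : e₀ p q x = none) : f₀ p q x ≠ none := by
  obtain ⟨⟨⟨⟨⟩, x₁⟩, x₂⟩, x₃⟩ := x
  simp only [e₀, f₀] at he ⊢
  split_ifs at he ⊢ <;> simp_all

theorem zero_one (ha : f₀ p q x = some a) :
    0 < phi p q x ∧ (f p q x = some a ↔ phi p q x = 1) := by
  have hl := injective_two hpq
  obtain ⟨m, hm⟩ := Over.exists ![p, q] x
  obtain ⟨a', ha', hoa⟩ := rel_some (hm.f₀_rel hl 0 1) ha
  have h := (model_zero_one m).1 a' ha'
  rw [← hm.phi_eq hl 0 1] at h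
  refine ⟨h.1, fun h1 => h.2.1 ?_, fun h1 => common (hm.f_rel hl 0 1) (h.2.2 h1) hoa⟩
  obtain ⟨b', hb', hob⟩ := rel_some (hm.f_rel hl 0 1) h1
  rw [hb', hob.right_unique hl hoa]

theorem zero_one_up (ha : e₀ p q x = some a) (hb : e p q x = some b) (hab : a ≠ b) :
    ∃ w, e p q a = some w ∧ e₀ p q b = some w ∧ phi p q w = 3 := by
  have hl := injective_two hpq
  obtain ⟨m, hm⟩ := Over.exists ![p, q] x
  obtain ⟨a', ha', hoa⟩ := rel_some (hm.e₀_rel hl 0 1) ha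
  obtain ⟨b', hb', hob⟩ := rel_some (hm.e_rel hl 0 1) hb
  obtain ⟨w', hw1, hw2, hw3⟩ := (model_zero_one m).2.1 a' ha' b' hb' fun h => hab (by
    subst h
    exact hoa.unique hob)
  obtain ⟨w, hw, how⟩ := rel_some' (hoa.e_rel hl 0 1) hw1
  exact ⟨w, hw, common (hob.e₀_rel hl 0 1) hw2 how, (how.phi_eq hl 0 1).trans hw3⟩

theorem zero_one_down (ha : f₀ p q x = some a) (hb : f p q x = some b) (hx : phi p q x = 3) :
    ∃ w, f p q a = some w ∧ f₀ p q b = some w := by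
  have hl := injective_two hpq
  obtain ⟨m, hm⟩ := Over.exists ![p, q] x
  obtain ⟨a', ha', hoa⟩ := rel_some (hm.f₀_rel hl 0 1) ha
  obtain ⟨b', hb', hob⟩ := rel_some (hm.f_rel hl 0 1) hb
  obtain ⟨w', hw1, hw2⟩ := (model_zero_one m).2.2 a' ha' b' hb'
    ((hm.phi_eq hl 0 1).symm.trans hx)
  obtain ⟨w, hw, how⟩ := rel_some' (hoa.f_rel hl 0 1) hw1
  exact ⟨w, hw, common (hob.f₀_rel hl 0 1) hw2 how⟩

end Two

/-! ### Adjacent colours -/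

section Three

set_option synthInstance.maxHeartbeats 400000 in
set_option synthInstance.maxSize 4000 in
theorem model_up : ∀ x : W (Option (Fin 3)),
    ∀ a ∈ e (some 0) (some 1) x, ∀ b ∈ e (some 1) (some 2) x,
    (∃ w ∈ e (some 1) (some 2) a, e (some 0) (some 1) b = some w ∧
      (phi (some 0) (some 1) w = phi (some 0) (some 1) a ∨
        phi (some 1) (some 2) w = phi (some 1) (some 2) b)) ∨
    ∃ a₁ ∈ e (some 1) (some 2) a, ∃ a₂ ∈ e (some 1) (some 2) a₁, ∃ w ∈ e (some 0) (some 1) a₂,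
      ∃ b₁ ∈ e (some 0) (some 1) b, ∃ b₂ ∈ e (some 0) (some 1) b₁, e (some 1) (some 2) b₂ = some w ∧
      phi (some 1) (some 2) a₂ = phi (some 1) (some 2) w + 1 ∧
      phi (some 0) (some 1) b₂ = phi (some 0) (some 1) w + 1 := by
  decide +kernel

set_option synthInstance.maxHeartbeats 400000 in
set_option synthInstance.maxSize 4000 in
-- Both length conditions are admitted, since the two adjacent colours may come in either order.
theorem model_down : ∀ w : W (Option (Fin 3)),
    ∀ b ∈ f (some 0) (some 1) w, ∀ a ∈ f (some 1) (some 2) w,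
    (phi (some 0) (some 1) w = phi (some 0) (some 1) a ∨
      phi (some 1) (some 2) w = phi (some 1) (some 2) b →
      ∃ x ∈ f (some 0) (some 1) a, f (some 1) (some 2) b = some x) ∧
    (phi (some 1) (some 2) b = phi (some 1) (some 2) w + 1 →
      phi (some 0) (some 1) a = phi (some 0) (some 1) w + 1 →
      ∃ b₁ ∈ f (some 1) (some 2) b, ∃ b₂ ∈ f (some 1) (some 2) b₁, ∃ x ∈ f (some 0) (some 1) b₂,
        ∃ a₁ ∈ f (some 0) (some 1) a, ∃ a₂ ∈ f (some 0) (some 1) a₁,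
          f (some 1) (some 2) a₂ = some x) := by
  decide +kernel

set_option synthInstance.maxHeartbeats 400000 in
set_option synthInstance.maxSize 4000 in
theorem model_zero_two : ∀ w : W (Option (Fin 3)),
    ∀ a ∈ f₀ (some 0) (some 1) w, ∀ b ∈ f (some 1) (some 2) w,
      f (some 1) (some 2) a = f₀ (some 0) (some 1) b := by
  decide +kernel

variable {p q s : A} (hpq : p ≠ q) (hqs : q ≠ s) (hps : p ≠ s) {x a b : W A}

include hpq hqs hps

theorem up_adjacent (ha : e p q x = some a) (hb : e q s x = some b) :
    (∃ w, e q s a = some w ∧ e p q b = some w ∧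
      (phi p q w = phi p q a ∨ phi q s w = phi q s b)) ∨
    ∃ a₁ a₂ b₁ b₂ w, e q s a = some a₁ ∧ e q s a₁ = some a₂ ∧ e p q a₂ = some w ∧
      e p q b = some b₁ ∧ e p q b₁ = some b₂ ∧ e q s b₂ = some w ∧
      phi q s a₂ = phi q s w + 1 ∧ phi p q b₂ = phi p q w + 1 := by
  have hl := injective_three hpq hqs hps
  obtain ⟨m, hm⟩ := Over.exists ![p, q, s] x
  obtain ⟨a', ha', hoa⟩ := rel_some (hm.e_rel hl 0 1) ha
  obtain ⟨b', hb', hob⟩ := rel_some (hm.e_rel hl 1 2) hb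
  rcases model_up m a' ha' b' hb' with ⟨w', h1, h2, h3⟩ |
    ⟨a₁', h1, a₂', h2, w', h3, b₁', h4, b₂', h5, h6, h7, h8⟩
  · obtain ⟨w, hw, how⟩ := rel_some' (hoa.e_rel hl 1 2) h1
    rw [← how.phi_eq hl 0 1, ← hoa.phi_eq hl 0 1, ← how.phi_eq hl 1 2, ← hob.phi_eq hl 1 2] at h3
    exact .inl ⟨w, hw, common (hob.e_rel hl 0 1) h2 how, h3⟩
  · obtain ⟨a₁, g1, o1⟩ := rel_some' (hoa.e_rel hl 1 2) h1
    obtain ⟨a₂, g2, o2⟩ := rel_some' (o1.e_rel hl 1 2) h2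
    obtain ⟨w, g3, o3⟩ := rel_some' (o2.e_rel hl 0 1) h3
    obtain ⟨b₁, g4, o4⟩ := rel_some' (hob.e_rel hl 0 1) h4
    obtain ⟨b₂, g5, o5⟩ := rel_some' (o4.e_rel hl 0 1) h5
    rw [← o2.phi_eq hl 1 2, ← o3.phi_eq hl 1 2] at h7
    rw [← o5.phi_eq hl 0 1, ← o3.phi_eq hl 0 1] at h8
    exact .inr ⟨a₁, a₂, b₁, b₂, w, g1, g2, g3, g4, g5, common (o5.e_rel hl 1 2) h6 o3, h7, h8⟩

theorem down_square_adjacent (hb : f p q x = some b) (ha : f q s x = some a)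
    (hx : phi p q x = phi p q a ∨ phi q s x = phi q s b) :
    ∃ y, f p q a = some y ∧ f q s b = some y := by
  have hl := injective_three hpq hqs hps
  obtain ⟨m, hm⟩ := Over.exists ![p, q, s] x
  obtain ⟨b', hb', hob⟩ := rel_some (hm.f_rel hl 0 1) hb
  obtain ⟨a', ha', hoa⟩ := rel_some (hm.f_rel hl 1 2) ha
  have key := (model_down m b' hb' a' ha').1
  rw [← hm.phi_eq hl 0 1, ← hoa.phi_eq hl 0 1, ← hm.phi_eq hl 1 2, ← hob.phi_eq hl 1 2] at key
  obtain ⟨y', h1, h2⟩ := key hx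
  obtain ⟨y, hy, hoy⟩ := rel_some' (hoa.f_rel hl 0 1) h1
  exact ⟨y, hy, common (hob.f_rel hl 1 2) h2 hoy⟩

theorem down_hexagon_adjacent (hb : f p q x = some b) (ha : f q s x = some a)
    (h1 : phi q s b = phi q s x + 1) (h2 : phi p q a = phi p q x + 1) :
    ∃ b₁ b₂ a₁ a₂ y, f q s b = some b₁ ∧ f q s b₁ = some b₂ ∧ f p q b₂ = some y ∧
      f p q a = some a₁ ∧ f p q a₁ = some a₂ ∧ f q s a₂ = some y := by
  have hl := injective_three hpq hqs hps
  obtain ⟨m, hm⟩ := Over.exists ![p, q, s] x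
  obtain ⟨b', hb', hob⟩ := rel_some (hm.f_rel hl 0 1) hb
  obtain ⟨a', ha', hoa⟩ := rel_some (hm.f_rel hl 1 2) ha
  have key := (model_down m b' hb' a' ha').2
  rw [← hm.phi_eq hl 0 1, ← hoa.phi_eq hl 0 1, ← hm.phi_eq hl 1 2, ← hob.phi_eq hl 1 2] at key
  obtain ⟨b₁', k1, b₂', k2, y', k3, a₁', k4, a₂', k5, k6⟩ := key h1 h2
  obtain ⟨b₁, g1, o1⟩ := rel_some' (hob.f_rel hl 1 2) k1
  obtain ⟨b₂, g2, o2⟩ := rel_some' (o1.f_rel hl 1 2) k2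
  obtain ⟨y, g3, o3⟩ := rel_some' (o2.f_rel hl 0 1) k3
  obtain ⟨a₁, g4, o4⟩ := rel_some' (hoa.f_rel hl 0 1) k4
  obtain ⟨a₂, g5, o5⟩ := rel_some' (o4.f_rel hl 0 1) k5
  exact ⟨b₁, b₂, a₁, a₂, y, g1, g2, g3, g4, g5, common (o5.f_rel hl 1 2) k6 o3⟩

theorem zero_two_down (ha : f₀ p q x = some a) (hb : f q s x = some b) : f q s a = f₀ p q b := by
  have hl := injective_three hpq hqs hps
  obtain ⟨m, hm⟩ := Over.exists ![p, q, s] x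
  obtain ⟨a', ha', hoa⟩ := rel_some (hm.f₀_rel hl 0 1) ha
  obtain ⟨b', hb', hob⟩ := rel_some (hm.f_rel hl 1 2) hb
  have key := model_zero_two m a' ha' b' hb'
  refine Option.ext fun y => ⟨fun hy => ?_, fun hy => ?_⟩
  · obtain ⟨y', hy', hoy⟩ := rel_some (hoa.f_rel hl 1 2) hy
    exact common (hob.f₀_rel hl 0 1) (key.symm.trans hy') hoy
  · obtain ⟨y', hy', hoy⟩ := rel_some (hob.f₀_rel hl 0 1) hy
    exact common (hoa.f_rel hl 1 2) (key.trans hy') hoy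

end Three

/-! ### Distant colours -/

section Four

set_option synthInstance.maxHeartbeats 400000 in
set_option synthInstance.maxSize 4000 in
-- Operators on disjoint pairs of letters commute. The last clause excludes the premise of the
-- hexagon axiom for distant colours.
theorem model_far : ∀ x : W (Option (Fin 4)),
    (∀ a ∈ e (some 0) (some 1) x, ∀ b ∈ e (some 2) (some 3) x,
      ∃ w ∈ e (some 2) (some 3) a, e (some 0) (some 1) b = some w ∧
        phi (some 0) (some 1) w = phi (some 0) (some 1) a) ∧
    (∀ b ∈ f (some 0) (some 1) x, ∀ a ∈ f (some 2) (some 3) x,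
      ∃ y ∈ f (some 0) (some 1) a, f (some 2) (some 3) b = some y) ∧
    (∀ b ∈ f (some 0) (some 1) x, phi (some 2) (some 3) b = phi (some 2) (some 3) x) := by
  decide +kernel

set_option synthInstance.maxHeartbeats 400000 in
set_option synthInstance.maxSize 4000 in
theorem model_zero_far : ∀ x : W (Option (Fin 4)),
    (∀ a ∈ f₀ (some 0) (some 1) x, phi (some 2) (some 3) a = phi (some 2) (some 3) x ∧
      ∀ b ∈ f (some 2) (some 3) x, f (some 2) (some 3) a = f₀ (some 0) (some 1) b) ∧
    (∀ a ∈ e₀ (some 0) (some 1) x, ∀ b ∈ e (some 2) (some 3) x,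
      ∃ w ∈ e (some 2) (some 3) a, e₀ (some 0) (some 1) b = some w) := by
  decide +kernel

variable {p q s t : A} (hpq : p ≠ q) (hst : s ≠ t) (hps : p ≠ s) (hpt : p ≠ t)
  (hqs : q ≠ s) (hqt : q ≠ t) {x a b : W A}

include hpq hst hps hpt hqs hqt

theorem up_far (ha : e p q x = some a) (hb : e s t x = some b) :
    ∃ w, e s t a = some w ∧ e p q b = some w ∧ phi p q w = phi p q a := by
  have hl := injective_four hpq hst hps hpt hqs hqt
  obtain ⟨m, hm⟩ := Over.exists ![p, q, s, t] x
  obtain ⟨a', ha', hoa⟩ := rel_some (hm.e_rel hl 0 1) ha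
  obtain ⟨b', hb', hob⟩ := rel_some (hm.e_rel hl 2 3) hb
  obtain ⟨w', h1, h2, h3⟩ := (model_far m).1 a' ha' b' hb'
  obtain ⟨w, hw, how⟩ := rel_some' (hoa.e_rel hl 2 3) h1
  rw [← how.phi_eq hl 0 1, ← hoa.phi_eq hl 0 1] at h3
  exact ⟨w, hw, common (hob.e_rel hl 0 1) h2 how, h3⟩

theorem down_far (hb : f p q x = some b) (ha : f s t x = some a) :
    ∃ y, f p q a = some y ∧ f s t b = some y := by
  have hl := injective_four hpq hst hps hpt hqs hqt
  obtain ⟨m, hm⟩ := Over.exists ![p, q, s, t] x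
  obtain ⟨b', hb', hob⟩ := rel_some (hm.f_rel hl 0 1) hb
  obtain ⟨a', ha', hoa⟩ := rel_some (hm.f_rel hl 2 3) ha
  obtain ⟨y', h1, h2⟩ := (model_far m).2.1 b' hb' a' ha'
  obtain ⟨y, hy, hoy⟩ := rel_some' (hoa.f_rel hl 0 1) h1
  exact ⟨y, hy, common (hob.f_rel hl 2 3) h2 hoy⟩

theorem phi_far (hb : f p q x = some b) : phi s t b = phi s t x := by
  have hl := injective_four hpq hst hps hpt hqs hqt
  obtain ⟨m, hm⟩ := Over.exists ![p, q, s, t] x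
  obtain ⟨b', hb', hob⟩ := rel_some (hm.f_rel hl 0 1) hb
  have key := (model_far m).2.2 b' hb'
  rwa [← hm.phi_eq hl 2 3, ← hob.phi_eq hl 2 3] at key

theorem zero_far_phi (ha : f₀ p q x = some a) : phi s t a = phi s t x := by
  have hl := injective_four hpq hst hps hpt hqs hqt
  obtain ⟨m, hm⟩ := Over.exists ![p, q, s, t] x
  obtain ⟨a', ha', hoa⟩ := rel_some (hm.f₀_rel hl 0 1) ha
  have key := ((model_zero_far m).1 a' ha').1
  rwa [← hm.phi_eq hl 2 3, ← hoa.phi_eq hl 2 3] at key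

theorem zero_far_down (ha : f₀ p q x = some a) (hb : f s t x = some b) : f s t a = f₀ p q b := by
  have hl := injective_four hpq hst hps hpt hqs hqt
  obtain ⟨m, hm⟩ := Over.exists ![p, q, s, t] x
  obtain ⟨a', ha', hoa⟩ := rel_some (hm.f₀_rel hl 0 1) ha
  obtain ⟨b', hb', hob⟩ := rel_some (hm.f_rel hl 2 3) hb
  have key := ((model_zero_far m).1 a' ha').2 b' hb'
  refine Option.ext fun y => ⟨fun hy => ?_, fun hy => ?_⟩
  · obtain ⟨y', hy', hoy⟩ := rel_some (hoa.f_rel hl 2 3) hy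
    exact common (hob.f₀_rel hl 0 1) (key.symm.trans hy') hoy
  · obtain ⟨y', hy', hoy⟩ := rel_some (hob.f₀_rel hl 0 1) hy
    exact common (hoa.f_rel hl 2 3) (key.trans hy') hoy

theorem zero_far_up (ha : e₀ p q x = some a) (hb : e s t x = some b) :
    ∃ w, e s t a = some w ∧ e₀ p q b = some w := by
  have hl := injective_four hpq hst hps hpt hqs hqt
  obtain ⟨m, hm⟩ := Over.exists ![p, q, s, t] x
  obtain ⟨a', ha', hoa⟩ := rel_some (hm.e₀_rel hl 0 1) ha
  obtain ⟨b', hb', hob⟩ := rel_some (hm.e_rel hl 2 3) hb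
  obtain ⟨w', h1, h2⟩ := (model_zero_far m).2 a' ha' b' hb'
  obtain ⟨w, hw, how⟩ := rel_some' (hoa.e_rel hl 2 3) h1
  exact ⟨w, hw, common (hob.e₀_rel hl 0 1) h2 how⟩

end Four

end Word

/-! ### The third tensor power of the standard crystal -/

theorem sub_one_ne {i : Fin (r + 1)} (hi : i ≠ 0) : i - 1 ≠ i := fun hh => by
  have := val_sub_one hi
  rw [hh] at this
  omega

theorem standard_eps {i : Fin (r + 1)} (hi : i ≠ 0) (a : Fin (r + 1)) :
    (standard r).eps i a = Word.ind i a := by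
  refine IsLength.sSup_eq (l := Word.ind i) (fun x => ⟨fun hx => ?_, fun y hy => ?_⟩) a
  · simp only [standard, if_neg hi] at hx
    split_ifs at hx with h
    exact if_neg h
  · simp only [standard, if_neg hi] at hy
    split_ifs at hy with h
    obtain rfl := Option.some_inj.1 hy
    simp [Word.ind, h, sub_one_ne hi]

theorem standard_wt_eq_zero (a : Fin (r + 1)) :
    ((standard r).wt a 0 = 0 ∧ (standard r).wt a 1 = 0) ↔ a ≠ 0 ∧ a ≠ 1 := by
  simp [standard, Pi.single_apply, eq_comm]

theorem mk_congr {V : Type u} {e e' f f' : Fin (r + 1) → V → Option V}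
    {wt wt' : V → Fin (r + 1) → ℤ} (he : ∀ i x, e i x = e' i x) (hf : ∀ i x, f i x = f' i x)
    (hwt : ∀ x, wt x = wt' x) : QueerGraph.mk V e f wt = QueerGraph.mk V e' f' wt' := by
  obtain rfl : e = e' := funext fun i => funext (he i)
  obtain rfl : f = f' := funext fun i => funext (hf i)
  obtain rfl : wt = wt' := funext hwt
  rfl

/-- The tensor product with the standard crystal, in terms of letters. -/
theorem tensor_standard {V : Type} {e f : Fin (r + 1) → V → Option V} {wt : V → Fin (r + 1) → ℤ}
    (P : Fin (r + 1) → V → ℕ) (hP : ∀ i, i ≠ 0 → IsLength (f i) (P i))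
    {e' f' : Fin (r + 1) → V × Fin (r + 1) → Option (V × Fin (r + 1))}
    {wt' : V × Fin (r + 1) → Fin (r + 1) → ℤ}
    (he₀ : ∀ b c, e' 0 (b, c) = if c ≠ 0 ∧ c ≠ 1 then (e 0 b).map fun d => (d, c)
      else if c = 1 then some (b, 0) else none)
    (he : ∀ i, i ≠ 0 → ∀ b c, e' i (b, c) = if Word.ind i c ≤ P i b then
      (e i b).map fun d => (d, c) else if c = i then some (b, i - 1) else none)
    (hf₀ : ∀ b c, f' 0 (b, c) = if c ≠ 0 ∧ c ≠ 1 then (f 0 b).map fun d => (d, c)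
      else if c = 0 then some (b, 1) else none)
    (hf : ∀ i, i ≠ 0 → ∀ b c, f' i (b, c) = if Word.ind i c < P i b then
      (f i b).map fun d => (d, c) else if c = i - 1 then some (b, i) else none)
    (hwt : ∀ b c, wt' (b, c) = wt b + Pi.single c 1) :
    (QueerGraph.mk V e f wt).tensor (standard r) = QueerGraph.mk (V × Fin (r + 1)) e' f' wt' := by
  -- The tensor rule uses only `φ_i` of the left factor, supplied as `P`, and `ε_i` of a single
  -- letter, which is an indicator.
  have hphi : ∀ i, i ≠ 0 → ∀ b, (QueerGraph.mk V e f wt).phi i b = P i b :=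
    fun i hi b => (hP i hi).sSup_eq b
  refine mk_congr (fun i x => ?_) (fun i x => ?_) (fun x => (hwt x.1 x.2).symm)
  · suffices h : ∀ (b : V) (c : Fin (r + 1)),
        ((QueerGraph.mk V e f wt).tensor (standard r)).e i (b, c) = e' i (b, c) from h x.1 x.2
    intro b c
    by_cases hi : i = 0
    · refine (if_pos hi).trans ?_
      subst hi
      refine Eq.trans ?_ (he₀ b c).symm
      by_cases hc : c ≠ 0 ∧ c ≠ 1
      · exact (if_pos ((standard_wt_eq_zero c).2 hc)).trans (if_pos hc).symm
      · refine (if_neg fun h => hc ((standard_wt_eq_zero c).1 h)).trans ?_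
        refine Eq.trans ?_ (if_neg hc).symm
        have hstd : (standard r).e 0 c = if c = 1 then some (0 : Fin (r + 1)) else none := by
          simp [standard]
        refine (congrArg (Option.map _) hstd).trans ?_
        by_cases hc1 : c = 1
        · exact (congrArg (Option.map _) (if_pos hc1)).trans (if_pos hc1).symm
        · exact (congrArg (Option.map _) (if_neg hc1)).trans (if_neg hc1).symm
    · refine (if_neg hi).trans ?_
      refine Eq.trans ?_ (he i hi b c).symm
      have hiff := Iff.of_eq (congrArg₂ (· ≤ ·) (standard_eps hi c) (hphi i hi b))
      by_cases hlt : Word.ind i c ≤ P i b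
      · exact (if_pos (hiff.2 hlt)).trans (if_pos hlt).symm
      · refine (if_neg fun h => hlt (hiff.1 h)).trans (Eq.trans ?_ (if_neg hlt).symm)
        refine (congrArg (Option.map _) (if_neg hi)).trans ?_
        by_cases hc1 : c = i
        · exact (congrArg (Option.map _) (if_pos hc1)).trans (if_pos hc1).symm
        · exact (congrArg (Option.map _) (if_neg hc1)).trans (if_neg hc1).symm
  · suffices h : ∀ (b : V) (c : Fin (r + 1)),
        ((QueerGraph.mk V e f wt).tensor (standard r)).f i (b, c) = f' i (b, c) from h x.1 x.2
    intro b c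
    by_cases hi : i = 0
    · refine (if_pos hi).trans ?_
      subst hi
      refine Eq.trans ?_ (hf₀ b c).symm
      by_cases hc : c ≠ 0 ∧ c ≠ 1
      · exact (if_pos ((standard_wt_eq_zero c).2 hc)).trans (if_pos hc).symm
      · refine (if_neg fun h => hc ((standard_wt_eq_zero c).1 h)).trans ?_
        refine Eq.trans ?_ (if_neg hc).symm
        have hstd : (standard r).f 0 c = if c = 0 then some (1 : Fin (r + 1)) else none := by
          simp [standard]
        refine (congrArg (Option.map _) hstd).trans ?_
        by_cases hc1 : c = 0
        · exact (congrArg (Option.map _) (if_pos hc1)).trans (if_pos hc1).symm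
        · exact (congrArg (Option.map _) (if_neg hc1)).trans (if_neg hc1).symm
    · refine (if_neg hi).trans ?_
      refine Eq.trans ?_ (hf i hi b c).symm
      have hiff := Iff.of_eq (congrArg₂ (· < ·) (standard_eps hi c) (hphi i hi b))
      by_cases hlt : Word.ind i c < P i b
      · exact (if_pos (hiff.2 hlt)).trans (if_pos hlt).symm
      · refine (if_neg fun h => hlt (hiff.1 h)).trans (Eq.trans ?_ (if_neg hlt).symm)
        refine (congrArg (Option.map _) (if_neg hi)).trans ?_
        by_cases hc1 : c = i - 1
        · exact (congrArg (Option.map _) (if_pos hc1)).trans (if_pos hc1).symm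
        · exact (congrArg (Option.map _) (if_neg hc1)).trans (if_neg hc1).symm

/-- The crystal of words of length three. -/
def cube (r : ℕ) : QueerGraph.{0} r where
  V := Word.W (Fin (r + 1))
  e i := if i = 0 then Word.e₀ 0 1 else Word.e (i - 1) i
  f i := if i = 0 then Word.f₀ 0 1 else Word.f (i - 1) i
  wt x := Pi.single x.1.1.2 1 + Pi.single x.1.2 1 + Pi.single x.2 1

/-- The crystal of words of length one. -/
def letters (r : ℕ) : QueerGraph.{0} r where
  V := Unit × Fin (r + 1)
  e i x := if i = 0 then (if x.2 = 1 then some ((), 0) else none)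
    else if x.2 = i then some ((), i - 1) else none
  f i x := if i = 0 then (if x.2 = 0 then some ((), 1) else none)
    else if x.2 = i - 1 then some ((), i) else none
  wt x := Pi.single x.2 1

/-- The crystal of words of length two. -/
def square (r : ℕ) : QueerGraph.{0} r where
  V := (Unit × Fin (r + 1)) × Fin (r + 1)
  e i x := if i = 0 then (if x.2 ≠ 0 ∧ x.2 ≠ 1 then if x.1.2 = 1 then some (((), 0), x.2) else none
      else if x.2 = 1 then some (x.1, 0) else none)
    else if Word.ind i x.2 ≤ Word.ind (i - 1) x.1.2 then
      if x.1.2 = i then some (((), i - 1), x.2) else none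
    else if x.2 = i then some (x.1, i - 1) else none
  f i x := if i = 0 then (if x.2 ≠ 0 ∧ x.2 ≠ 1 then if x.1.2 = 0 then some (((), 1), x.2) else none
      else if x.2 = 0 then some (x.1, 1) else none)
    else if Word.ind i x.2 < Word.ind (i - 1) x.1.2 then
      if x.1.2 = i - 1 then some (((), i), x.2) else none
    else if x.2 = i - 1 then some (x.1, i) else none
  wt x := Pi.single x.1.2 1 + Pi.single x.2 1

theorem standardPow_one : standardPow r 1 = letters r := by
  refine tensor_standard (fun _ _ => 0) (fun i hi x => ⟨fun _ => rfl, fun y hy => (Option.some_ne_none y hy.symm).elim⟩)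
    (fun b c => ?_) (fun i hi b c => ?_) (fun b c => ?_) (fun i hi b c => ?_) (fun b c => ?_)
  · simp only [if_true]
    split_ifs <;> simp_all
  · simp only [if_neg hi, Word.ind]
    split_ifs <;> simp_all
  · simp only [if_true]
    split_ifs <;> simp_all
  · simp [if_neg hi]
  · simp

theorem standardPow_two : standardPow r 2 = square r := by
  change (standardPow r 1).tensor (standard r) = _
  rw [standardPow_one]
  refine tensor_standard (fun i x => Word.ind (i - 1) x.2) (fun i hi x => ?_)
    (fun b c => ?_) (fun i hi b c => ?_) (fun b c => ?_) (fun i hi b c => ?_) (fun b c => ?_)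
  · have h1 := sub_one_ne hi
    have h2 := h1.symm
    simp only [if_neg hi, Word.ind]
    refine ⟨fun hx => ?_, fun y hy => ?_⟩
    · split_ifs at hx; simp_all
    · split_ifs at hy
      obtain rfl := Option.some_inj.1 hy
      simp_all
  · simp only [if_true]
    split_ifs <;> simp_all
  · simp only [if_neg hi]
    split_ifs <;> simp_all
  · simp only [if_true]
    split_ifs <;> simp_all
  · simp only [if_neg hi]
    split_ifs <;> simp_all
  · rfl

theorem standardPow_three : standardPow r 3 = cube r := by
  change (standardPow r 2).tensor (standard r) = _
  rw [standardPow_two]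
  refine tensor_standard (fun i x => Word.phi₂ (i - 1) i x.1.2 x.2) (fun i hi x => ?_)
    (fun b c => ?_) (fun i hi b c => ?_) (fun b c => ?_) (fun i hi b c => ?_) (fun b c => ?_)
  · obtain ⟨⟨⟨⟩, a⟩, b⟩ := x
    have h1 := sub_one_ne hi
    have h2 := h1.symm
    simp only [if_neg hi, Word.phi₂, Word.ind]
    refine ⟨fun hx => ?_, fun y hy => ?_⟩
    · split_ifs at hx ⊢ <;> simp_all
    · split_ifs at hy <;> (obtain rfl := Option.some_inj.1 hy; simp_all)
  · obtain ⟨⟨⟨⟩, a⟩, b⟩ := b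
    simp only [if_true, Word.e₀]
    split_ifs <;> simp_all
  · obtain ⟨⟨⟨⟩, a⟩, b⟩ := b
    simp only [if_neg hi, Word.e]
    split_ifs <;> simp_all
  · obtain ⟨⟨⟨⟩, a⟩, b⟩ := b
    simp only [if_true, Word.f₀]
    split_ifs <;> simp_all
  · obtain ⟨⟨⟨⟩, a⟩, b⟩ := b
    simp only [if_neg hi, Word.f]
    split_ifs <;> simp_all
  · rfl

namespace Word

variable {A : Type*} [DecidableEq A] {p q : A} {x y : W A}

theorem wt_e (h : e p q x = some y) :
    (Pi.single y.1.1.2 1 + Pi.single y.1.2 1 + Pi.single y.2 1 : A → ℤ) =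
      Pi.single x.1.1.2 1 + Pi.single x.1.2 1 + Pi.single x.2 1 +
        (Pi.single p 1 - Pi.single q 1) := by
  obtain ⟨⟨⟨⟨⟩, a⟩, b⟩, c⟩ := x
  simp only [e] at h
  split_ifs at h with _ _ ha hb hc
  · subst ha
    rw [← Option.some_inj.1 h]
    abel
  · subst hb
    rw [← Option.some_inj.1 h]
    abel
  · subst hc
    rw [← Option.some_inj.1 h]
    abel

theorem wt_e₀ (h : e₀ p q x = some y) :
    (Pi.single y.1.1.2 1 + Pi.single y.1.2 1 + Pi.single y.2 1 : A → ℤ) =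
      Pi.single x.1.1.2 1 + Pi.single x.1.2 1 + Pi.single x.2 1 +
        (Pi.single p 1 - Pi.single q 1) := by
  obtain ⟨⟨⟨⟨⟩, a⟩, b⟩, c⟩ := x
  simp only [e₀] at h
  split_ifs at h with _ _ ha hb hc
  · subst ha
    rw [← Option.some_inj.1 h]
    abel
  · subst hb
    rw [← Option.some_inj.1 h]
    abel
  · subst hc
    rw [← Option.some_inj.1 h]
    abel

end Word

/-! ### Operators, string lengths and confluence of the crystal of words -/

theorem cube_e {i : Fin (r + 1)} (hi : i ≠ 0) : (cube r).e i = Word.e (i - 1) i := if_neg hi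

theorem cube_f {i : Fin (r + 1)} (hi : i ≠ 0) : (cube r).f i = Word.f (i - 1) i := if_neg hi

theorem cube_e_zero : (cube r).e 0 = Word.e₀ 0 1 := by
  simp [cube]

theorem cube_f_zero : (cube r).f 0 = Word.f₀ 0 1 := by
  simp [cube]

theorem cube_phi {i : Fin (r + 1)} (hi : i ≠ 0) : (cube r).phi i = Word.phi (i - 1) i := by
  funext x
  unfold phi
  rw [cube_f hi]
  exact (Word.isLength_f (sub_one_ne hi)).sSup_eq x

theorem cube_eps {i : Fin (r + 1)} (hi : i ≠ 0) : (cube r).eps i = Word.eps (i - 1) i := by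
  funext x
  unfold eps
  rw [cube_e hi]
  exact (Word.isLength_e (sub_one_ne hi)).sSup_eq x

theorem cube_wt (x : (cube r).V) (j : Fin (r + 1)) :
    (cube r).wt x j = Word.ind j x.1.1.2 + Word.ind j x.1.2 + Word.ind j x.2 := by
  simp [cube, Word.ind, Pi.single_apply, eq_comm]

/-- The length function of an operator that can be applied at most once. -/
theorem isLength_of_once {V : Type u} {g : V → Option V} (h : ∀ x y, g x = some y → g y = none) :
    IsLength g fun x => if g x = none then 0 else 1 := by
  refine fun x => ⟨fun hx => if_pos hx, fun y hy => ?_⟩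
  simp [hy, h x y hy]

theorem cube_eps_zero (hr : 1 ≤ r) (x : (cube r).V) :
    (cube r).eps 0 x = if Word.e₀ 0 1 x = none then 0 else 1 := by
  have h01 : (0 : Fin (r + 1)) ≠ 1 := fun hh => by simpa [← hh] using val_one hr
  unfold eps
  rw [cube_e_zero]
  exact (isLength_of_once fun _ _ => Word.e₀_e₀ h01).sSup_eq x

theorem cube_phi_zero (hr : 1 ≤ r) (x : (cube r).V) :
    (cube r).phi 0 x = if Word.f₀ 0 1 x = none then 0 else 1 := by
  have h01 : (0 : Fin (r + 1)) ≠ 1 := fun hh => by simpa [← hh] using val_one hr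
  unfold phi
  rw [cube_f_zero]
  exact (isLength_of_once fun _ _ => Word.f₀_f₀ h01).sSup_eq x

theorem cube_isWeightedGraph (hr : 1 ≤ r) : (cube r).IsWeightedGraph where
  edge i x y := by
    by_cases hi : i = 0
    · subst hi
      rw [cube_e_zero, cube_f_zero]
      exact Word.e₀_iff_f₀ fun hh => by simpa [← hh] using val_one hr
    · rw [cube_e hi, cube_f hi]
      exact Word.e_iff_f (sub_one_ne hi)
  wt_edge i x y h := by
    by_cases hi : i = 0
    · subst hi
      rw [cube_e_zero] at h
      rw [opRoot, if_pos rfl, simpleRoot, sub_self]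
      exact Word.wt_e₀ h
    · rw [cube_e hi] at h
      rw [opRoot, if_neg hi]
      exact Word.wt_e h
  string i hi x := by
    rw [cube_phi hi, cube_eps hi, cube_wt, cube_wt]
    obtain ⟨⟨⟨⟨⟩, a⟩, b⟩, c⟩ := x
    simp only [Word.phi, Word.eps, Word.phi₂]
    omega

theorem cube_hasDegree : (cube r).HasDegree 3 := by
  refine fun x => ⟨fun j => by rw [cube_wt]; positivity, ?_⟩
  simp only [cube, Pi.add_apply, Finset.sum_add_distrib, Finset.sum_pi_single']
  simp

/-- Colour `i` acts on the letters `i - 1` and `i`, so two colours share one letter, in one of two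
orders, or none. The inequalities make the letters involved distinct. -/
theorem colour_cases {i j : Fin (r + 1)} (hi : i ≠ 0) (hj : j ≠ 0) (hij : i ≠ j) :
    (j - 1 = i ∧ i - 1 ≠ j) ∨ (i - 1 = j ∧ j - 1 ≠ i) ∨
    (i - 1 ≠ j - 1 ∧ i - 1 ≠ j ∧ i ≠ j - 1) := by
  have h1 := val_sub_one hi
  have h2 := val_sub_one hj
  simp only [ne_eq, Fin.ext_iff] at hij ⊢
  omega

theorem zero_colour {i : Fin (r + 1)} (hi : 3 ≤ (i : ℕ)) :
    i ≠ 0 ∧ 0 ≠ i - 1 ∧ 0 ≠ i ∧ 1 ≠ i - 1 ∧ 1 ≠ i := by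
  have hi0 : i ≠ 0 := fun hh => by simp [hh] at hi
  have h1 := val_sub_one hi0
  have h2 := val_one (r := r) (by have := i.2; omega)
  simp only [ne_eq, Fin.ext_iff, Fin.val_zero, h2]
  omega

/-- Words of length three form a confluent graph. -/
theorem cube_isConfluent (hr : 1 ≤ r) : (cube r).IsConfluent := by
  have h01 : (0 : Fin (r + 1)) ≠ 1 := fun hh => by simpa [← hh] using val_one hr
  have colour_one : ∀ i : Fin (r + 1), (i : ℕ) = 1 → i = 1 := fun i hi =>
    Fin.ext (hi.trans (val_one hr).symm)
  refine { toIsWeightedGraph := cube_isWeightedGraph hr, degree := cube_hasDegree, length_e := ?length_e, length_f := ?length_f, zero_length := ?zero_length, up := ?up, down_square := ?down_square, down_hexagon := ?down_hexagon, zero_down := ?zero_down, zero_far_phi := ?zero_far_phi, zero_far_up := ?zero_far_up, zero_one := ?zero_one, zero_one_up := ?zero_one_up, zero_one_down := ?zero_one_down }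
  case length_e =>
    intro i
    by_cases hi : i = 0
    · subst hi
      rw [cube_e_zero, funext (cube_eps_zero hr)]
      exact isLength_of_once fun _ _ => Word.e₀_e₀ h01
    · rw [cube_e hi, cube_eps hi]
      exact Word.isLength_e (sub_one_ne hi)
  case length_f =>
    intro i
    by_cases hi : i = 0
    · subst hi
      rw [cube_f_zero, funext (cube_phi_zero hr)]
      exact isLength_of_once fun _ _ => Word.f₀_f₀ h01
    · rw [cube_f hi, cube_phi hi]
      exact Word.isLength_f (sub_one_ne hi)
  case zero_length =>
    intro x hx
    rw [cube_eps_zero hr, cube_phi_zero hr]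
    cases he : Word.e₀ 0 1 x with
    | some y => simp [Word.f₀_eq_none h01 he]
    | none =>
      have := Word.f₀_ne_none (p := (0 : Fin (r + 1))) (q := 1) (x := x) (by
        by_contra! hne
        obtain ⟨h1, h2, h3, h4, h5, h6⟩ := hne
        rw [cube_wt, cube_wt] at hx
        simp [Word.ind, h1, h2, h3, h4, h5, h6] at hx) he
      simp [this]
  case up =>
    intro i j hi hj hij x a b ha hb
    have hpq := sub_one_ne hi
    have hst := sub_one_ne hj
    rw [cube_e hi] at ha ⊢
    rw [cube_e hj] at hb ⊢
    rw [cube_phi hi, cube_phi hj]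
    rcases colour_cases hi hj hij with ⟨h1, h2⟩ | ⟨h1, h2⟩ | ⟨h1, h2, h3⟩
    · rw [h1] at hb ⊢
      exact Word.up_adjacent hpq hij h2 ha hb
    · rw [h1] at ha ⊢
      rcases Word.up_adjacent hst hij.symm h2 hb ha with ⟨w, g1, g2, g3⟩ |
        ⟨a₁, a₂, b₁, b₂, w, g1, g2, g3, g4, g5, g6, g7, g8⟩
      · exact .inl ⟨w, g2, g1, g3.symm⟩
      · exact .inr ⟨b₁, b₂, a₁, a₂, w, g4, g5, g6, g1, g2, g3, g8, g7⟩
    · obtain ⟨w, g1, g2, g3⟩ := Word.up_far hpq hst h1 h2 h3 hij ha hb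
      exact .inl ⟨w, g1, g2, .inl g3⟩
  case down_square =>
    intro i j hi hj hij x a b hb ha hx
    have hpq := sub_one_ne hi
    have hst := sub_one_ne hj
    rw [cube_f hi] at hb ⊢
    rw [cube_f hj] at ha ⊢
    rw [cube_phi hi] at hx
    rcases colour_cases hi hj hij with ⟨h1, h2⟩ | ⟨h1, h2⟩ | ⟨h1, h2, h3⟩
    · rw [h1] at ha ⊢
      exact Word.down_square_adjacent hpq hij h2 hb ha (.inl hx)
    · rw [h1] at hb hx ⊢
      obtain ⟨y, g1, g2⟩ := Word.down_square_adjacent hst hij.symm h2 ha hb (.inr hx)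
      exact ⟨y, g2, g1⟩
    · exact Word.down_far hpq hst h1 h2 h3 hij hb ha
  case down_hexagon =>
    intro i j hi hj hij x b a hb ha hx₁ hx₂
    have hpq := sub_one_ne hi
    have hst := sub_one_ne hj
    rw [cube_f hi] at hb ⊢
    rw [cube_f hj] at ha ⊢
    rw [cube_phi hj] at hx₁
    rw [cube_phi hi] at hx₂
    rcases colour_cases hi hj hij with ⟨h1, h2⟩ | ⟨h1, h2⟩ | ⟨h1, h2, h3⟩
    · rw [h1] at ha hx₁ ⊢
      exact Word.down_hexagon_adjacent hpq hij h2 hb ha hx₁ hx₂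
    · rw [h1] at hb hx₂ ⊢
      obtain ⟨b₁, b₂, a₁, a₂, y, g1, g2, g3, g4, g5, g6⟩ :=
        Word.down_hexagon_adjacent hst hij.symm h2 ha hb hx₂ hx₁
      exact ⟨a₁, a₂, b₁, b₂, y, g4, g5, g6, g1, g2, g3⟩
    -- Distant colours do not change each other's string lengths, so the hexagon hypothesis is
    -- contradictory.
    · have := Word.phi_far hpq hst h1 h2 h3 hij hb
      omega
  case zero_down =>
    intro i hi w a b ha hb
    have hi0 : i ≠ 0 := fun hh => by simp [hh] at hi
    rw [cube_f_zero] at ha ⊢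
    rw [cube_f hi0] at hb ⊢
    rcases hi.lt_or_eq with h3 | h2
    · obtain ⟨-, k1, k2, k3, k4⟩ := zero_colour (i := i) (by omega)
      exact Word.zero_far_down h01 (sub_one_ne hi0) k1 k2 k3 k4 ha hb
    · have hi1 : i - 1 = 1 := colour_one _ (by have := val_sub_one hi0; omega)
      rw [hi1] at hb ⊢
      refine Word.zero_two_down h01 (fun hh => ?_) hi0.symm ha hb
      have := val_one hr
      rw [hh] at this
      omega
  case zero_far_phi =>
    intro i hi w a ha
    obtain ⟨hi0, k1, k2, k3, k4⟩ := zero_colour hi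
    rw [cube_f_zero] at ha
    rw [cube_phi hi0]
    exact Word.zero_far_phi h01 (sub_one_ne hi0) k1 k2 k3 k4 ha
  case zero_far_up =>
    intro i hi x a b ha hb
    obtain ⟨hi0, k1, k2, k3, k4⟩ := zero_colour hi
    rw [cube_e_zero] at ha ⊢
    rw [cube_e hi0] at hb ⊢
    exact Word.zero_far_up h01 (sub_one_ne hi0) k1 k2 k3 k4 ha hb
  case zero_one =>
    intro i hi w a ha
    obtain rfl := colour_one i hi
    rw [cube_f_zero] at ha
    rw [cube_f h01.symm, cube_phi h01.symm, sub_self]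
    exact Word.zero_one h01 ha
  case zero_one_up =>
    intro i hi x a b ha hb hab
    obtain rfl := colour_one i hi
    rw [cube_e_zero] at ha ⊢
    rw [cube_e h01.symm, sub_self] at hb ⊢
    rw [cube_phi h01.symm, sub_self]
    exact Word.zero_one_up h01 ha hb hab
  case zero_one_down =>
    intro i hi w a b ha hb hw
    obtain rfl := colour_one i hi
    rw [cube_f_zero] at ha ⊢
    rw [cube_f h01.symm, sub_self] at hb ⊢
    rw [cube_phi h01.symm, sub_self] at hw
    exact Word.zero_one_down h01 ha hb hw

/-! ### Sources and highest weight elements -/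

/-- The weight of a source. -/
theorem IsConfluent.wt_of_isSource {Y : QueerGraph.{u} r} (hr : 1 ≤ r) (hY : Y.IsConfluent) {y : Y.V}
    (hy : Y.IsSource y) : Y.wt y = wt21 r ∨ Y.wt y = wt3 r := by
  have v1 := val_one hr
  have h01 : (0 : Fin (r + 1)) ≠ 1 := fun hh => by simp [← hh] at v1
  have heps : ∀ i, Y.eps i y = 0 := fun i => (hY.length_e i y).1 (hy i)
  have hnn := (hY.degree y).1
  have hsum := (hY.degree y).2
  -- With `ε_i = 0` the difference of neighbouring coordinates is `φ_i ≥ 0`, so the weight is a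
  -- partition of 3.
  have hle : ∀ i : Fin (r + 1), i ≠ 0 → Y.wt y i ≤ Y.wt y (i - 1) := fun i hi => by
    have := hY.string i hi y
    rw [heps] at this
    omega
  have hone : ∀ k : ℕ, ∀ j : Fin (r + 1), (j : ℕ) = k + 1 → Y.wt y j ≤ Y.wt y 1 := by
    intro k
    induction k with
    | zero => exact fun j hj => (congrArg (Y.wt y) (Fin.ext (hj.trans v1.symm))).le
    | succ k ih =>
      intro j hj
      have hj0 : j ≠ 0 := fun hh => by simp [hh] at hj
      exact (hle j hj0).trans (ih _ (by have := val_sub_one hj0; omega))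
  have hone' : ∀ j : Fin (r + 1), j ≠ 0 → Y.wt y j ≤ Y.wt y 1 := fun j hj =>
    hone ((j : ℕ) - 1) j (by have := val_sub_one hj; omega)
  have h10 := hle 1 h01.symm
  rw [sub_self] at h10
  have hpos : 0 < Y.wt y 0 := by
    by_contra hneg
    have : ∑ j, Y.wt y j ≤ 0 := Finset.sum_nonpos fun j _ => by
      by_cases hj : j = 0
      · rw [hj]; omega
      · exact (hone' j hj).trans (by omega)
    omega
  -- As `ε_0 = 0`, the edge `f_0 y` exists and forces `φ_1(y) > 0`. Hence coordinate 0 strictly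
  -- exceeds coordinate 1, which rules out `(1, 1, 1, 0, …)`.
  have hlen := hY.zero_length y (by have := hnn 1; omega)
  rw [heps] at hlen
  obtain ⟨z, hz⟩ := (hY.length_f 0).exists_of_pos (x := y) (by omega)
  have hphi := (hY.zero_one 1 v1 y z hz).1
  have hstr := hY.string 1 h01.symm y
  rw [heps, sub_self] at hstr
  by_cases h1 : Y.wt y 1 = 0
  · right
    have hz : ∀ j : Fin (r + 1), j ≠ 0 → Y.wt y j = 0 := fun j hj =>
      le_antisymm ((hone' j hj).trans h1.le) (hnn j)
    rw [Finset.sum_eq_single 0 (fun j _ hj => hz j hj) (by simp)] at hsum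
    funext j
    by_cases hj : j = 0
    · simp [hj, wt3, hsum]
    · rw [hz j hj, wt3, if_neg fun hh : (j : ℕ) = 0 => hj (Fin.ext hh)]
  · left
    have hn1 := hnn 1
    have hpair : ∑ j ∈ ({0, 1} : Finset (Fin (r + 1))), Y.wt y j ≤ 3 := by
      rw [← hsum]
      exact Finset.sum_le_univ_sum_of_nonneg hnn
    rw [Finset.sum_pair h01] at hpair
    funext j
    by_cases hj : j = 0
    · rw [hj, wt21, if_pos (Fin.val_zero _)]
      omega
    by_cases hj1 : j = 1
    · rw [hj1, wt21, if_neg (by omega), if_pos v1]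
      omega
    have htriple : ∑ j ∈ ({0, 1, j} : Finset (Fin (r + 1))), Y.wt y j ≤ 3 := by
      rw [← hsum]
      exact Finset.sum_le_univ_sum_of_nonneg hnn
    rw [Finset.sum_insert (by simp [h01, Ne.symm hj]), Finset.sum_pair (Ne.symm hj1)] at htriple
    have hnj := hnn j
    rw [wt21, if_neg fun hh : (j : ℕ) = 0 => hj (Fin.ext hh),
      if_neg fun hh : (j : ℕ) = 1 => hj1 (Fin.ext (hh.trans v1.symm))]
    omega

theorem cube_isSource_three (hr : 1 ≤ r) :
    (cube r).IsSource ((((), 0), 0), 0) ∧ (cube r).wt ((((), 0), 0), 0) = wt3 r := by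
  have h01 : (0 : Fin (r + 1)) ≠ 1 := fun hh => by simpa [← hh] using val_one hr
  refine ⟨fun i => ?_, ?_⟩
  · by_cases hi : i = 0
    · rw [hi, cube_e_zero]
      simp [Word.e₀, h01]
      rfl
    · rw [cube_e hi]
      simp [Word.e, Ne.symm hi]
      rfl
  · funext j
    refine (cube_wt _ j).trans ?_
    by_cases hj : j = 0
    · simp [hj, Word.ind, wt3]
    · have hj' : (j : ℕ) ≠ 0 := fun hh => hj (Fin.ext hh)
      simp [Ne.symm hj, Word.ind, wt3, hj]

/-- Of the three words of this weight only `0 1 0` works: the letter `1` is bracketed with the `0`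
before it, which stops `e_1`, and the last letter is `0`, which stops `e_0`. -/
theorem cube_isSource_two_one (hr : 1 ≤ r) :
    (cube r).IsSource ((((), 0), 1), 0) ∧ (cube r).wt ((((), 0), 1), 0) = wt21 r := by
  have v1 := val_one hr
  have h01 : (0 : Fin (r + 1)) ≠ 1 := fun hh => by simp [← hh] at v1
  refine ⟨fun i => ?_, ?_⟩
  · by_cases hi : i = 0
    · rw [hi, cube_e_zero]
      simp [Word.e₀, h01]
      rfl
    · rw [cube_e hi]
      by_cases hi1 : i = 1
      · subst hi1
        simp [Word.e, Word.ind, h01]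
        rfl
      · simp [Word.e, Ne.symm hi, Ne.symm hi1]
        rfl
  · funext j
    refine (cube_wt _ j).trans ?_
    by_cases hj : j = 0
    · simp [hj, Word.ind, wt21, h01.symm]
    by_cases hj1 : j = 1
    · subst hj1
      rw [wt21, if_neg (by omega), if_pos v1]
      simp [Word.ind, h01]
    · have h1 : (j : ℕ) ≠ 0 := fun hh => hj (Fin.ext hh)
      have h2 : (j : ℕ) ≠ 1 := fun hh => hj1 (Fin.ext (hh.trans v1.symm))
      rw [wt21, if_neg h1, if_neg h2]
      simp [Word.ind, Ne.symm hj, Ne.symm hj1]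

/-- Each tensor factor contributes one unit, so a weight reveals the tensor power in which it
occurs. -/
theorem standardPow_sum_wt (k : ℕ) (x : (standardPow r k).V) :
    ∑ j, (standardPow r k).wt x j = k := by
  induction k with
  | zero => exact Finset.sum_const_zero
  | succ k ih =>
    have h : ∀ j, (standardPow r (k + 1)).wt x j =
        (standardPow r k).wt x.1 j + (Pi.single x.2 1 : Fin (r + 1) → ℤ) j := fun j => rfl
    have hs : ∀ a : Fin (r + 1), ∑ j, (Pi.single a 1 : Fin (r + 1) → ℤ) j = 1 := by simp
    simp only [h, Finset.sum_add_distrib, ih, Nat.cast_succ]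
    exact congrArg _ (hs x.2)

/-! ### Weights under the reflection operators -/

section Reflect

variable {Y : QueerGraph.{u} r} (h : Y.IsWeightedGraph)

include h

theorem IsWeightedGraph.wt_iter_e {i : Fin (r + 1)} {k : ℕ} {x y : Y.V}
    (hxy : iter (Y.e i) k x = some y) : Y.wt y = Y.wt x + (k : ℤ) • opRoot i := by
  induction k generalizing y with
  | zero =>
    obtain rfl := Option.some_inj.1 hxy
    simp
  | succ k ih =>
    rw [iter, Option.bind_eq_some_iff] at hxy
    obtain ⟨z, hz, hzy⟩ := hxy
    rw [h.wt_edge i z y hzy, ih hz]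
    push_cast
    rw [add_smul, one_smul, add_assoc]

theorem IsWeightedGraph.wt_iter_f {i : Fin (r + 1)} {k : ℕ} {x y : Y.V}
    (hxy : iter (Y.f i) k x = some y) : Y.wt x = Y.wt y + (k : ℤ) • opRoot i := by
  induction k generalizing y with
  | zero =>
    obtain rfl := Option.some_inj.1 hxy
    simp
  | succ k ih =>
    rw [iter, Option.bind_eq_some_iff] at hxy
    obtain ⟨z, hz, hzy⟩ := hxy
    rw [ih hz, h.wt_edge i y z (h.f_iff.1 hzy)]
    push_cast
    rw [add_smul, one_smul, add_assoc, add_comm (opRoot i)]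

/-- The number of steps along the string equals the difference of the two coordinates, so they are
exchanged. This needs only that the result is defined. -/
theorem IsWeightedGraph.wt_reflect {i : Fin (r + 1)} (hi : i ≠ 0) {x y : Y.V}
    (hxy : Y.reflect i x = some y) :
    Y.wt y = Y.wt x - (Y.wt x (i - 1) - Y.wt x i) • simpleRoot i := by
  have hroot : opRoot i = simpleRoot i := if_neg hi
  unfold reflect at hxy
  by_cases hd : 0 ≤ Y.wt x (i - 1) - Y.wt x i
  · have := h.wt_iter_f ((if_pos hd).symm.trans hxy)
    rw [Int.toNat_of_nonneg hd, hroot] at this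
    exact eq_sub_of_add_eq this.symm
  · have := h.wt_iter_e ((if_neg hd).symm.trans hxy)
    rw [Int.toNat_of_nonneg (by omega), hroot] at this
    rw [this, neg_smul]
    exact (sub_eq_add_neg _ _).symm

theorem IsWeightedGraph.wt_reflect_sub_one {i : Fin (r + 1)} (hi : i ≠ 0) {x y : Y.V}
    (hxy : Y.reflect i x = some y) : Y.wt y (i - 1) = Y.wt x i := by
  rw [h.wt_reflect hi hxy]
  simp [simpleRoot_apply, sub_one_ne hi]

theorem IsWeightedGraph.wt_reflect_of_ne {i j : Fin (r + 1)} (hi : i ≠ 0) (hj : j ≠ i - 1)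
    (hij : j ≠ i) {x y : Y.V} (hxy : Y.reflect i x = some y) : Y.wt y j = Y.wt x j := by
  rw [h.wt_reflect hi hxy]
  simp [simpleRoot_apply, hj, hij]

omit h in
theorem val_ofNat {k : ℕ} (hk : k ≤ r) : ((Fin.ofNat (r + 1) k : Fin (r + 1)) : ℕ) = k :=
  Nat.mod_eq_of_lt (by omega)

omit h in
theorem ofNat_ne_zero {k : ℕ} (hk : k ≤ r) (h0 : 0 < k) : Fin.ofNat (r + 1) k ≠ 0 := fun hh => by
  have := val_ofNat hk
  rw [hh, Fin.val_zero] at this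
  omega

/-- Reflections in smaller colours do not move a coordinate. -/
theorem IsWeightedGraph.wt_reflect_lower {i : Fin (r + 1)} (l : List ℕ)
    (hl : ∀ k ∈ l, 0 < k ∧ k < i) {x y : Y.V}
    (hxy : (l.map (Fin.ofNat (r + 1))).foldrM Y.reflect x = some y) : Y.wt y i = Y.wt x i := by
  induction l generalizing y with
  | nil =>
    obtain rfl := Option.some_inj.1 hxy
    rfl
  | cons k l ih =>
    rw [List.map_cons, List.foldrM_cons] at hxy
    obtain ⟨z, hz, hzy⟩ := Option.bind_eq_some_iff.1 hxy
    obtain ⟨hk0, hki⟩ := hl k List.mem_cons_self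
    have hkr : k ≤ r := by have := i.2; omega
    have hne := ofNat_ne_zero hkr hk0
    have h1 := val_ofNat hkr
    have h2 := val_sub_one hne
    rw [← ih (fun k' hk' => hl k' (List.mem_cons_of_mem _ hk')) hz]
    refine h.wt_reflect_of_ne hne (fun hh => ?_) (fun hh => ?_) hzy
    · rw [← hh] at h2
      omega
    · rw [← hh] at h1
      omega

/-- The reflections `s_2 ⋯ s_{m + 1}` move the coordinate `m + 1` (counted from `0`) to `1`. -/
theorem IsWeightedGraph.wt_reflect_shift (m : ℕ) (hm : m + 1 ≤ r) {x y : Y.V}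
    (hxy : ((List.range' 2 m).map (Fin.ofNat (r + 1))).foldrM Y.reflect x = some y) :
    Y.wt y 1 = Y.wt x (Fin.ofNat (r + 1) (m + 1)) := by
  induction m generalizing x with
  | zero =>
    obtain rfl := Option.some_inj.1 hxy
    exact congrArg _ (Fin.ext ((val_one hm).trans (val_ofNat hm).symm))
  | succ m ih =>
    rw [List.range'_concat, List.map_append, List.foldrM_append] at hxy
    obtain ⟨z, hz, hzy⟩ := Option.bind_eq_some_iff.1 hxy
    have hz' : Y.reflect (Fin.ofNat (r + 1) (m + 2)) x = some z := by
      simpa [add_comm 2 m] using hz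
    have hne := ofNat_ne_zero (r := r) hm (Nat.succ_pos _)
    rw [ih (by omega) hzy, ← h.wt_reflect_sub_one hne hz']
    refine congrArg _ (Fin.ext ?_)
    have h1 := val_sub_one hne
    rw [val_ofNat hm] at h1
    rw [val_ofNat (by omega)]
    omega

end Reflect

theorem oddE_one {Y : QueerGraph.{u} r} (hr : 1 ≤ r) (x : Y.V) : Y.oddE 1 x = Y.e 0 x := by
  simp only [oddE, oddWord, val_one hr]
  simp

theorem IsHighestWeight.isSource {Y : QueerGraph.{u} r} (hr : 1 ≤ r) {x : Y.V}
    (hx : Y.IsHighestWeight x) : Y.IsSource x := by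
  intro i
  by_cases hi : i = 0
  · have h01 : (1 : Fin (r + 1)) ≠ 0 := fun hh => by simpa [hh] using val_one hr
    rw [hi, ← oddE_one hr]
    exact (hx 1 h01).2
  · exact (hx i hi).1

/-- A source of weight `(2, 1, 0, …)` or `(3, 0, 0, …)` is a highest weight element. -/
theorem IsConfluent.isHighestWeight {Y : QueerGraph.{u} r} (hr : 1 ≤ r) (hY : Y.IsConfluent)
    {x : Y.V} (hx : Y.IsSource x) : Y.IsHighestWeight x := by
  refine fun i hi => ⟨hx i, ?_⟩
  have v1 := val_one hr
  by_cases hi1 : i = 1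
  · rw [hi1, oddE_one hr]
    exact hx 0
  have hv : 2 ≤ (i : ℕ) := by
    have := val_sub_one hi
    have : (i : ℕ) ≠ 1 := fun hh => hi1 (Fin.ext (hh.trans v1.symm))
    omega
  have hwt : Y.wt x i = 0 := by
    rcases hY.wt_of_isSource hr hx with hw | hw <;> rw [hw]
    · rw [wt21, if_neg (by omega), if_neg (by omega)]
    · rw [wt3, if_neg (by omega)]
  by_contra hne
  obtain ⟨y, hy⟩ := Option.ne_none_iff_exists'.1 hne
  rw [oddE, Option.bind_eq_some_iff] at hy
  obtain ⟨d, hd, -⟩ := hy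
  rw [Option.bind_eq_some_iff] at hd
  obtain ⟨c, hc, hcd⟩ := hd
  rw [oddWord, List.map_append, List.foldrM_append] at hc
  obtain ⟨z, hz, hzc⟩ := Option.bind_eq_some_iff.1 hc
  have hi2 := i.2
  -- The reflections `S_1 ⋯ S_{i-1}` act first and leave the zero coordinate `i` alone; `S_2 ⋯ S_i`
  -- then carry it to position 1. There `e_0` would make it negative.
  have h1 := hY.wt_reflect_lower (i := i) _ (fun k hk => by
    rw [List.mem_range'_1] at hk
    omega) hz
  have h2 := hY.wt_reflect_shift _ (by omega) hzc
  have h3 : Fin.ofNat (r + 1) ((i : ℕ) - 1 + 1) = i :=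
    Fin.ext ((val_ofNat (by omega)).trans (by omega))
  rw [h3, h1, hwt] at h2
  have h4 := hY.wt_e_zero hcd 1
  have h5 := (hY.degree d).1 1
  have h01 : (1 : Fin (r + 1)) ≠ 0 := fun hh => by simp [hh] at v1
  rw [if_neg h01, if_pos rfl] at h4
  omega

/-- Two graphs which are isomorphic to the same graph are isomorphic. -/
def Iso.transSymm {X : QueerGraph.{u} r} {Y : QueerGraph.{v} r} {Z : QueerGraph.{0} r}
    (φ : X.Iso Z) (ψ : Y.Iso Z) : X.Iso Y where
  toEquiv := φ.toEquiv.trans ψ.toEquiv.symm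
  map_e i x := by
    apply Option.map_injective ψ.toEquiv.injective
    rw [← ψ.map_e, Option.map_map]
    simp [φ.map_e, Function.comp_def]
  map_f i x := by
    apply Option.map_injective ψ.toEquiv.injective
    rw [← ψ.map_f, Option.map_map]
    simp [φ.map_f, Function.comp_def]
  map_wt x := by
    rw [← ψ.map_wt, ← φ.map_wt]
    simp

/-- A component contains the upper end of every edge into it, so a source of the component is a
source of the whole graph. -/
theorem Iso.isSource {X : QueerGraph.{u} r} {Z : QueerGraph.{v} r} (hX : X.IsConfluent)
    {b : X.V} (φ : Z.Iso (X.component b)) {z : Z.V} (hz : Z.IsSource z) :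
    X.IsSource (φ.toEquiv z).1 := by
  intro i
  by_contra hne
  obtain ⟨x, hx⟩ := Option.ne_none_iff_exists'.1 hne
  have hlink : X.Linked b x :=
    (φ.toEquiv z).2.trans _ _ _ (.symm _ _ (.rel _ _ ⟨i, hX.f_iff.2 hx⟩))
  have h1 : (X.component b).e i (φ.toEquiv z) = some ⟨x, hlink⟩ := by
    change (X.e i (φ.toEquiv z).1).bind _ = _
    rw [hx]
    exact dif_pos hlink
  rw [φ.map_e, hz i] at h1
  exact Option.some_ne_none _ h1.symm

theorem standardPow_three_isConfluent (hr : 1 ≤ r) : (standardPow r 3).IsConfluent := by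
  rw [standardPow_three]
  exact cube_isConfluent hr

end QueerGraph

theorem mainTheorem6 (r : ℕ) (hr : 1 ≤ r) (Y : QueerGraph.{u} r)
    (hreg : Y.IsRegularQueer) (hconn : Y.IsConnected) (hdeg : Y.HasDegree 3) :
    Y.IsConnectedNormal ∧
      ∃ γ, (γ = QueerGraph.wt21 r ∨ γ = QueerGraph.wt3 r) ∧
        Y.IsNormalWithHighestWeight γ ∧
        ∀ Z : QueerGraph.{v} r, Z.IsNormalWithHighestWeight γ → Nonempty (Y.Iso Z) := by
  have hY := hreg.isConfluent hdeg
  obtain ⟨u, hu⟩ := hY.exists_isSource hr hconn.1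
  have hwt := hY.wt_of_isSource hr hu
  have hnormal : Y.IsConnectedNormal := by
    refine ⟨hreg.isQueerCrystal hconn.1, hconn, 3, ?_⟩
    rw [QueerGraph.standardPow_three]
    have hX := QueerGraph.cube_isConfluent hr
    rcases hwt with hw | hw
    · obtain ⟨h1, h2⟩ := QueerGraph.cube_isSource_two_one hr
      exact ⟨_, hX.nonempty_iso hr hY h1 hu (h2.trans hw.symm) hconn (.refl _)⟩
    · obtain ⟨h1, h2⟩ := QueerGraph.cube_isSource_three hr
      exact ⟨_, hX.nonempty_iso hr hY h1 hu (h2.trans hw.symm) hconn (.refl _)⟩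
  refine ⟨hnormal, Y.wt u, hwt, ⟨hnormal, u, hY.isHighestWeight hr hu, rfl, fun b hb =>
    hY.eq_of_isSource hr hu hconn (hb.isSource hr)⟩, ?_⟩
  rintro Z ⟨⟨-, -, k, b, ⟨φ⟩⟩, z, hz, hzw, -⟩
  have hw : (QueerGraph.standardPow r k).wt (φ.toEquiv z).1 = Y.wt u := (φ.map_wt z).trans hzw
  -- The weight of the highest weight element of `Z` has sum `k` as a weight of the tensor power,
  -- and sum 3 as the weight of `u`.
  have hk : (k : ℤ) = 3 := by
    rw [← QueerGraph.standardPow_sum_wt k (φ.toEquiv z).1, hw, (hdeg u).2]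
  obtain rfl : k = 3 := by omega
  have hX := QueerGraph.standardPow_three_isConfluent hr
  -- The image of `z` is a source of the third tensor power with the weight of `u`, so rigidity
  -- identifies `Y` with the component containing `Z`'s image.
  obtain ⟨ψ⟩ := hX.nonempty_iso hr hY (φ.isSource hX (hz.isSource hr)) hu hw hconn
    (φ.toEquiv z).2
  exact ⟨ψ.transSymm φ⟩
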